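/- Let $\mathcal C$ be the set of all closed subsets of $\mathbb R$ with the Effros $\sigma$-field $\mathcal B$, generated by the functions $C\mapsto\min_{s\in C}|s-t|$, $t\in\mathbb R$ (equal to $1$ for $C=\emptyset$). An equivalence class of measures is a nonempty set $\mathcal M$ of finite positive measures which, together with a measure $\mu$, contains exactly the finite positive measures equivalent to $\mu$. Call an equivalence class $\mathcal M$ of measures on $(\mathcal C,\mathcal B)$ decomposable if (a) for each $s\in\mathbb R$ there is a probability measure $\mu\in\mathcal M$ for which the $\sigma$-fields generated by $C\mapsto C\cap(-\infty,s]$ and by $C\mapsto C\cap[s,\infty)$ are independent; (b) for each $t\in\mathbb R$ the set $\{C\in\mathcal C: t\in C\}$ is $\mathcal M$-negligible. For $s<t$ let $\mathcal M_{s,t}$ be the image of $\mathcal M$ under $C\mapsto C\cap[s,t]$, an equivalence class of measures on the space $\mathcal C_{s,t}$ of closed subsets of $[s,t]$. Let $L_2(\mathcal M_{s,t})$ be the Hilbert space (real or complex) of families $(\psi_\mu)_{\mu\in\mathcal M_{s,t}}$ with $\psi_\mu\in L_2(\mu)$ and $\psi_\nu=\sqrt{d\mu/d\nu}\,\psi_\mu$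 for all $\mu,\nu\in\mathcal M_{s,t}$, with $\langle\psi,\varphi\rangle=\langle\psi_\mu,\varphi_\mu\rangle_{L_2(\mu)}$ for any $\mu$; write $f\sqrt\mu$ for the family with $\psi_\mu=f$. For decomposable $\mathcal M$, the spaces $H_{s,t}=L_2(\mathcal M_{s,t})$, $0\le s<t\le1$, with the unitary operators $$W_{r,s,t}:H_{r,s}\otimes H_{s,t}\to H_{r,t},\qquad f\sqrt\mu\otimes g\sqrt\nu\mapsto (f\otimes g)\sqrt{\mu\otimes\nu},$$ where $\mathcal C_{r,t}$ is identified mod $0$ with $\mathcal C_{r,s}\times\mathcal C_{s,t}$ by $C\mapsto(C\cap[r,s],C\cap[s,t])$, form a continuous product of Hilbert spaces over $[0,1]$: a family of nonzero separable Hilbert spaces with unitary operators $W_{r,s,t}$ satisfying $W_{r,t,u}(W_{r,s,t}\otimes\mathbf 1)=W_{r,s,u}(\mathbf 1\otimes W_{s,t,u})$ for $0\le r<s<t<u\le1$. An isomorphism from $(H,W)$ to $(H',W')$ is a family of unitary operators $U_{s,t}:H_{s,t}\to H'_{s,t}$, $0\le s<t\le1$, such that $U_{r,t}W_{r,s,t}=W'_{r,s,t}(U_{r,s}\otimes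 U_{s,t})$ for all $0\le r<s<t\le1$. **Corollary 5.9.** Let $\mathcal M,\mathcal M'$ be decomposable equivalence classes of measures on $\mathcal C$, both such that almost all sets $C\in\mathcal C$ are perfect (closed without isolated points; $\emptyset$ is perfect). Assume that their images $\mathcal M_{0,1},\mathcal M'_{0,1}$ under the map $C\mapsto C\cap[0,1]$ are different equivalence classes of measures on $\mathcal C_{0,1}$. Then the continuous products of Hilbert spaces $(L_2(\mathcal M_{s,t}))_{0\le s<t\le1}$ and $(L_2(\mathcal M'_{s,t}))_{0\le s<t\le1}$ over $[0,1]$ are not isomorphic. -/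

import Mathlib

noncomputable section

open MeasureTheory TopologicalSpace

namespace Effros

/-- The distance from the point `t` to the closed set `C`, with the convention that it equals `1`
when `C` is empty. -/
def distFn (t : ℝ) (C : Closeds ℝ) : ℝ :=
  open Classical in if C = ⊥ then 1 else Metric.infDist t (C : Set ℝ)

/-- The Effros σ-field on the space of closed subsets of the line: it is generated by the
functions `C ↦ min_{s ∈ C} |s - t|`, indexed by `t : ℝ`. -/
instance effros : MeasurableSpace (Closeds ℝ) :=
  ⨆ t : ℝ, MeasurableSpace.comap (distFn t) (borel ℝ)

theorem measurable_distFn (t : ℝ) : Measurable (distFn t) := by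
  rw [measurable_iff_comap_le, BorelSpace.measurable_eq (α := ℝ)]
  exact le_iSup (fun t : ℝ => MeasurableSpace.comap (distFn t) (borel ℝ)) t

theorem ne_bot_iff {C : Closeds ℝ} : C ≠ ⊥ ↔ (C : Set ℝ).Nonempty := by
  rw [Set.nonempty_iff_ne_empty, Ne, Ne, ← Closeds.coe_bot, SetLike.coe_set_eq]

theorem distFn_lt_iff {t r : ℝ} {C : Closeds ℝ} (hC : C ≠ ⊥) :
    distFn t C < r ↔ ((C : Set ℝ) ∩ Metric.ball t r).Nonempty := by
  rw [distFn, if_neg hC, Metric.infDist_lt_iff (ne_bot_iff.1 hC)]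
  constructor
  · rintro ⟨y, hy, h⟩
    exact ⟨y, hy, by rwa [Metric.mem_ball, dist_comm]⟩
  · rintro ⟨y, hy, h⟩
    exact ⟨y, hy, by rwa [Metric.mem_ball, dist_comm] at h⟩

theorem measurableSet_bot : MeasurableSet {C : Closeds ℝ | C = ⊥} := by
  have : {C : Closeds ℝ | C = ⊥} = ⋂ q : ℚ, distFn (q : ℝ) ⁻¹' {1} := by
    ext C
    simp only [Set.mem_ofPred_eq, Set.mem_iInter, Set.mem_preimage, Set.mem_singleton_iff]
    constructor
    · intro h q
      simp [distFn, h]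
    · intro h
      by_contra hC
      obtain ⟨x, hx⟩ := ne_bot_iff.1 hC
      obtain ⟨q, hq1, hq2⟩ := exists_rat_btwn (show x < x + 1 by linarith)
      have : distFn (q : ℝ) C < 1 := (distFn_lt_iff hC).2 ⟨x, hx, by
        rw [Metric.mem_ball, Real.dist_eq, abs_lt]; constructor <;> linarith⟩
      rw [h q] at this
      exact lt_irrefl _ this
  rw [this]
  exact MeasurableSet.iInter fun q => measurable_distFn _ (measurableSet_singleton 1)

theorem measurableSet_hit_ball (t r : ℝ) :
    MeasurableSet {C : Closeds ℝ | ((C : Set ℝ) ∩ Metric.ball t r).Nonempty} := by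
  have : {C : Closeds ℝ | ((C : Set ℝ) ∩ Metric.ball t r).Nonempty}
      = {C | C = ⊥}ᶜ ∩ distFn t ⁻¹' Set.Iio r := by
    ext C
    simp only [Set.mem_ofPred_eq, Set.mem_inter_iff, Set.mem_compl_iff, Set.mem_preimage,
      Set.mem_Iio]
    constructor
    · intro h
      have hC : C ≠ ⊥ := ne_bot_iff.2 (h.mono Set.inter_subset_left)
      exact ⟨hC, (distFn_lt_iff hC).2 h⟩
    · rintro ⟨hC, h⟩
      exact (distFn_lt_iff hC).1 h
  rw [this]
  exact measurableSet_bot.compl.inter (measurable_distFn t measurableSet_Iio)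

/-- Every open subset of the line is a union of balls with rational centres and radii. -/
theorem open_eq_iUnion (U : Set ℝ) (hU : IsOpen U) :
    U = ⋃ p : {p : ℚ × ℚ // Metric.ball (p.1 : ℝ) (p.2 : ℝ) ⊆ U},
      Metric.ball (p.1.1 : ℝ) (p.1.2 : ℝ) := by
  apply Set.Subset.antisymm
  · intro x hx
    obtain ⟨ε, hε, hsub⟩ := Metric.isOpen_iff.1 hU x hx
    obtain ⟨r, hr0, hr⟩ := exists_rat_btwn (show (0 : ℝ) < ε / 2 by linarith)
    obtain ⟨q, hq1, hq2⟩ := exists_rat_btwn (show x < x + r by linarith)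
    refine Set.mem_iUnion.2 ⟨⟨(q, r), ?_⟩, ?_⟩
    · intro y hy
      apply hsub
      simp only [Metric.mem_ball, Real.dist_eq, abs_lt] at hy ⊢
      constructor <;> linarith
    · simp only [Metric.mem_ball, Real.dist_eq, abs_lt]
      constructor <;> linarith
  · exact Set.iUnion_subset fun p => p.2

theorem measurableSet_hit {U : Set ℝ} (hU : IsOpen U) :
    MeasurableSet {C : Closeds ℝ | ((C : Set ℝ) ∩ U).Nonempty} := by
  rw [open_eq_iUnion U hU]
  simp only [Set.inter_iUnion, Set.nonempty_iUnion, Set.ofPred_exists]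
  exact MeasurableSet.iUnion fun p => measurableSet_hit_ball _ _

/-- A σ-field containing the sets `{C | C ∩ B ≠ ∅}`, for all balls `B` with rational centres and
radii, contains the Effros σ-field. -/
theorem effros_le (m : MeasurableSpace (Closeds ℝ))
    (h : ∀ q r : ℚ,
      MeasurableSet[m] {C : Closeds ℝ | ((C : Set ℝ) ∩ Metric.ball (q : ℝ) (r : ℝ)).Nonempty}) :
    effros ≤ m := by
  have hopen : ∀ U : Set ℝ, IsOpen U →
      MeasurableSet[m] {C : Closeds ℝ | ((C : Set ℝ) ∩ U).Nonempty} := by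
    intro U hU
    rw [open_eq_iUnion U hU]
    simp only [Set.inter_iUnion, Set.nonempty_iUnion, Set.ofPred_exists]
    exact MeasurableSet.iUnion fun p => h _ _
  have hbot : MeasurableSet[m] {C : Closeds ℝ | C = ⊥} := by
    have : {C : Closeds ℝ | C = ⊥} = {C : Closeds ℝ | ((C : Set ℝ) ∩ Set.univ).Nonempty}ᶜ := by
      ext C
      have := ne_bot_iff (C := C)
      simp only [Set.mem_ofPred_eq, Set.mem_compl_iff, Set.inter_univ]
      rw [← this, not_not]
    rw [this]
    exact (hopen _ isOpen_univ).compl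
  unfold effros
  refine iSup_le fun t => ?_
  rw [← BorelSpace.measurable_eq (α := ℝ), ← measurable_iff_comap_le]
  refine measurable_of_Iio fun a => ?_
  have : distFn t ⁻¹' Set.Iio a = ({C | C = ⊥} ∩ {_C | (1 : ℝ) < a}) ∪
      {C : Closeds ℝ | ((C : Set ℝ) ∩ Metric.ball t a).Nonempty} := by
    ext C
    by_cases hC : C = ⊥
    · subst hC
      simp [distFn]
    · simp [hC, distFn_lt_iff hC]
  rw [this]
  exact (hbot.inter (MeasurableSet.const _)).union (hopen _ Metric.isOpen_ball)

theorem measurable_of_hit {X : Type*} [MeasurableSpace X] {f : X → Closeds ℝ}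
    (h : ∀ U : Set ℝ, IsOpen U → MeasurableSet {x | ((f x : Set ℝ) ∩ U).Nonempty}) :
    Measurable f := by
  rw [measurable_iff_le_map]
  exact effros_le (MeasurableSpace.map f inferInstance) fun q r =>
    h (Metric.ball (q : ℝ) (r : ℝ)) Metric.isOpen_ball

instance : MeasurableSpace.CountablyGenerated (Closeds ℝ) := by
  refine ⟨Set.range fun p : ℚ × ℚ =>
    {C : Closeds ℝ | ((C : Set ℝ) ∩ Metric.ball (p.1 : ℝ) (p.2 : ℝ)).Nonempty},
    Set.countable_range _, le_antisymm ?_ ?_⟩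
  · exact effros_le (MeasurableSpace.generateFrom _) fun q r =>
      MeasurableSpace.measurableSet_generateFrom (Set.mem_range_self (q, r))
  · refine MeasurableSpace.generateFrom_le ?_
    rintro _ ⟨p, rfl⟩
    exact measurableSet_hit_ball _ _

theorem measurableSet_hit_compact {K : Set ℝ} (hK : IsCompact K) :
    MeasurableSet {C : Closeds ℝ | ((C : Set ℝ) ∩ K).Nonempty} := by
  have : {C : Closeds ℝ | ((C : Set ℝ) ∩ K).Nonempty} =
      ⋂ n : ℕ, {C : Closeds ℝ | ((C : Set ℝ) ∩ Metric.thickening (1 / (n + 1 : ℝ)) K).Nonempty} := by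
    ext C
    simp only [Set.mem_ofPred_eq, Set.mem_iInter]
    constructor
    · rintro ⟨x, hx, hxK⟩ n
      exact ⟨x, hx, Metric.self_subset_thickening (by positivity) _ hxK⟩
    · intro h
      by_contra hne
      rw [Set.not_nonempty_iff_eq_empty, ← Set.disjoint_iff_inter_eq_empty] at hne
      obtain ⟨δ, hδ, hd⟩ := hne.symm.exists_thickenings hK C.isClosed
      obtain ⟨n, hn⟩ := exists_nat_one_div_lt hδ
      obtain ⟨x, hx, hxK⟩ := h n
      exact Set.disjoint_left.1 hd (Metric.thickening_mono hn.le _ hxK)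
        (Metric.self_subset_thickening hδ _ hx)
  rw [this]
  exact MeasurableSet.iInter fun n => measurableSet_hit Metric.isOpen_thickening

theorem measurableSet_mem (t : ℝ) : MeasurableSet {C : Closeds ℝ | t ∈ C} := by
  have := measurableSet_hit_compact (isCompact_singleton (x := t))
  simpa [Set.inter_singleton_nonempty] using this

/-- The map `C ↦ C ∩ F`, for a closed set `F`, is measurable. -/
theorem measurable_inf (F : Closeds ℝ) : Measurable fun C : Closeds ℝ => C ⊓ F := by
  refine measurable_of_hit fun U hU => ?_
  obtain ⟨G, hG, -, hGU, -⟩ := hU.exists_iUnion_isClosed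
  have : {C : Closeds ℝ | (((C ⊓ F : Closeds ℝ) : Set ℝ) ∩ U).Nonempty} =
      ⋃ n : ℕ, ⋃ m : ℕ, {C : Closeds ℝ |
        ((C : Set ℝ) ∩ ((F : Set ℝ) ∩ G n ∩ Metric.closedBall 0 m)).Nonempty} := by
    ext C
    simp only [Set.mem_ofPred_eq, Set.mem_iUnion]
    constructor
    · rintro ⟨x, hx, hxU⟩
      rw [← hGU] at hxU
      obtain ⟨n, hn⟩ := Set.mem_iUnion.1 hxU
      obtain ⟨m, hm⟩ := exists_nat_ge |x|
      exact ⟨n, m, x, hx.1, ⟨hx.2, hn⟩, by simpa using hm⟩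
    · rintro ⟨n, m, x, hx, ⟨hxF, hxG⟩, -⟩
      exact ⟨x, ⟨hx, hxF⟩, hGU ▸ Set.mem_iUnion.2 ⟨n, hxG⟩⟩
  rw [this]
  exact MeasurableSet.iUnion fun n => MeasurableSet.iUnion fun m => measurableSet_hit_compact
    ((isCompact_closedBall (0 : ℝ) m).inter_left (F.isClosed.inter (hG n)))

/-- The map `(A, B) ↦ A ∪ B` is measurable. -/
theorem measurable_sup : Measurable fun P : Closeds ℝ × Closeds ℝ => P.1 ⊔ P.2 := by
  refine measurable_of_hit fun U hU => ?_
  have : {P : Closeds ℝ × Closeds ℝ | (((P.1 ⊔ P.2 : Closeds ℝ) : Set ℝ) ∩ U).Nonempty} =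
      Prod.fst ⁻¹' {C : Closeds ℝ | ((C : Set ℝ) ∩ U).Nonempty} ∪
      Prod.snd ⁻¹' {C : Closeds ℝ | ((C : Set ℝ) ∩ U).Nonempty} := by
    ext P
    simp [Set.union_inter_distrib_right, Set.union_nonempty]
  rw [this]
  exact (measurable_fst (measurableSet_hit hU)).union (measurable_snd (measurableSet_hit hU))

end Effros
end

noncomputable section

open MeasureTheory TopologicalSpace
open scoped ENNReal

/-- An equivalence class of measures on a measurable space: a nonempty set of finite measures
that contains, together with a measure `μ`, exactly the finite measures equivalent to `μ`. -/
@[ext]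
structure MeasureClass (X : Type*) [MeasurableSpace X] where
  carrier : Set (Measure X)
  nonempty : carrier.Nonempty
  finite : ∀ μ ∈ carrier, IsFiniteMeasure μ
  mem_iff : ∀ μ ∈ carrier, ∀ ν : Measure X, IsFiniteMeasure ν →
    (ν ∈ carrier ↔ ν ≪ μ ∧ μ ≪ ν)

namespace MeasureClass

variable {X Y : Type*} [MeasurableSpace X] [MeasurableSpace Y]

instance (M : MeasureClass X) (μ : M.carrier) : IsFiniteMeasure μ.1 := M.finite _ μ.2

theorem ac (M : MeasureClass X) (μ ν : M.carrier) : μ.1 ≪ ν.1 :=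
  ((M.mem_iff ν.1 ν.2 μ.1 inferInstance).1 μ.2).1

/-- A property holds for almost all points, with respect to a measure class. -/
def AlmostAll (M : MeasureClass X) (p : X → Prop) : Prop :=
  ∀ μ ∈ M.carrier, ∀ᵐ x ∂μ, p x

/-- A set is negligible, with respect to a measure class. -/
def Negligible (M : MeasureClass X) (s : Set X) : Prop :=
  ∀ μ ∈ M.carrier, μ s = 0

/-- Two sub-σ-fields are independent on a measure class if some probability measure of the class
makes them independent. (Adding the negligible sets to the σ-fields does not change this.) -/
def Independent {X : Type*} (m₁ m₂ : MeasurableSpace X) [MeasurableSpace X]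
    (M : MeasureClass X) : Prop :=
  ∃ μ ∈ M.carrier, IsProbabilityMeasure μ ∧ ProbabilityTheory.Indep m₁ m₂ μ

/-- The image of a measure class under a measurable map: it consists of the images of the
measures of the class. -/
def map (M : MeasureClass X) (f : X → Y) (hf : Measurable f) : MeasureClass Y where
  carrier := (fun μ : Measure X => μ.map f) '' M.carrier
  nonempty := M.nonempty.image _
  finite := by
    rintro _ ⟨μ, hμ, rfl⟩
    have := M.finite μ hμ
    exact Measure.isFiniteMeasure_map μ f
  mem_iff := by
    rintro _ ⟨μ, hμ, rfl⟩ ν hν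
    have := M.finite μ hμ
    constructor
    · rintro ⟨μ', hμ', rfl⟩
      have := M.finite μ' hμ'
      exact ⟨(M.ac ⟨μ', hμ'⟩ ⟨μ, hμ⟩).map hf, (M.ac ⟨μ, hμ⟩ ⟨μ', hμ'⟩).map hf⟩
    · rintro ⟨h1, h2⟩
      set d := ν.rnDeriv (μ.map f) with hd
      have hdm : Measurable d := Measure.measurable_rnDeriv _ _
      have hmap : (μ.withDensity (d ∘ f)).map f = ν := by
        rw [← Measure.withDensity_rnDeriv_eq ν (μ.map f) h1]
        ext s hs
        rw [Measure.map_apply hf hs, withDensity_apply _ (hf hs), withDensity_apply _ hs,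
          setLIntegral_map hs hdm hf]
        rfl
      refine ⟨μ.withDensity (d ∘ f), ?_, hmap⟩
      have hfin : IsFiniteMeasure (μ.withDensity (d ∘ f)) := by
        constructor
        rw [← Set.preimage_univ (f := f), ← Measure.map_apply hf MeasurableSet.univ, hmap]
        exact measure_lt_top _ _
      refine (M.mem_iff μ hμ _ hfin).2 ⟨withDensity_absolutelyContinuous _ _, ?_⟩
      refine withDensity_absolutelyContinuous' (hdm.comp hf).aemeasurable ?_
      have : ∀ᵐ y ∂(μ.map f), d y ≠ 0 :=
        (Measure.rnDeriv_pos' (μ := μ.map f) (ν := ν) h2).mono fun y hy => hy.ne'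
      exact ae_of_ae_map hf.aemeasurable this

/-! ### The Hilbert space of square roots of measures -/

/-- The families `ψ = (ψ_μ)_{μ ∈ M}` such that `ψ_μ ∈ L₂(μ)` for every `μ ∈ M`, and
`ψ_ν = √(dμ/dν) ψ_μ` for all `μ, ν ∈ M`. -/
def l2Families (𝕜 : Type*) [RCLike 𝕜] (M : MeasureClass X) :
    Submodule 𝕜 (∀ μ : M.carrier, Lp 𝕜 2 μ.1) where
  carrier := {ψ | ∀ μ ν : M.carrier, (ψ ν : X → 𝕜) =ᵐ[ν.1]
    fun x => (Real.sqrt (μ.1.rnDeriv ν.1 x).toReal : 𝕜) * ψ μ x}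
  zero_mem' := by
    intro μ ν
    filter_upwards [Lp.coeFn_zero 𝕜 2 ν.1, (M.ac ν μ) (Lp.coeFn_zero 𝕜 2 μ.1)] with x h1 h2
    simp only [Pi.zero_apply] at h1 h2 ⊢
    rw [h1, h2, mul_zero]
  add_mem' := by
    intro ψ φ hψ hφ μ ν
    filter_upwards [hψ μ ν, hφ μ ν, Lp.coeFn_add (ψ ν) (φ ν),
      (M.ac ν μ) (Lp.coeFn_add (ψ μ) (φ μ))] with x h1 h2 h3 h4
    simp only [Pi.add_apply] at h3 h4 ⊢
    rw [h3, h4, h1, h2, mul_add]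
  smul_mem' := by
    intro c ψ hψ μ ν
    filter_upwards [hψ μ ν, Lp.coeFn_smul c (ψ ν), (M.ac ν μ) (Lp.coeFn_smul c (ψ μ))]
      with x h1 h2 h3
    simp only [Pi.smul_apply, smul_eq_mul] at h2 h3 ⊢
    rw [h2, h3, h1]
    ring

/-- The Hilbert space `L₂(M)` of a measure class `M`. -/
def L2 (𝕜 : Type*) [RCLike 𝕜] (M : MeasureClass X) : Type _ := l2Families 𝕜 M

namespace L2

variable {𝕜 : Type*} [RCLike 𝕜] {M : MeasureClass X}

instance : AddCommGroup (L2 𝕜 M) := inferInstanceAs (AddCommGroup (l2Families 𝕜 M))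

instance : Module 𝕜 (L2 𝕜 M) := inferInstanceAs (Module 𝕜 (l2Families 𝕜 M))

/-- The incarnation of an element of `L₂(M)` in `L₂(μ)`, for a measure `μ` of the class. -/
def incarnation (μ : M.carrier) : L2 𝕜 M →ₗ[𝕜] Lp 𝕜 2 μ.1 where
  toFun ψ := ψ.1 μ
  map_add' _ _ := rfl
  map_smul' _ _ := rfl

theorem incarnation_eq (ψ : L2 𝕜 M) (μ ν : M.carrier) :
    (incarnation ν ψ : X → 𝕜) =ᵐ[ν.1]
      fun x => (Real.sqrt (μ.1.rnDeriv ν.1 x).toReal : 𝕜) * incarnation μ ψ x :=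
  ψ.2 μ ν

theorem incarnation_injective (μ : M.carrier) :
    Function.Injective (incarnation (𝕜 := 𝕜) μ) := by
  intro ψ φ h
  refine Subtype.ext (funext fun ν => Lp.ext ?_)
  filter_upwards [incarnation_eq ψ μ ν, incarnation_eq φ μ ν] with x h1 h2
  change incarnation ν ψ x = incarnation ν φ x
  rw [h1, h2, h]

theorem memLp_sqrt_mul (μ ν : M.carrier) (f : Lp 𝕜 2 μ.1) :
    MemLp (fun x => (Real.sqrt (μ.1.rnDeriv ν.1 x).toReal : 𝕜) * f x) 2 ν.1 := by
  have hm : AEStronglyMeasurable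
      (fun x => (Real.sqrt (μ.1.rnDeriv ν.1 x).toReal : 𝕜) * f x) ν.1 := by
    refine AEStronglyMeasurable.mul ?_ ?_
    · refine Measurable.aestronglyMeasurable ?_
      exact RCLike.measurable_ofReal.comp
        (Measure.measurable_rnDeriv μ.1 ν.1).ennreal_toReal.sqrt
    · exact (Lp.aestronglyMeasurable f).mono_ac (M.ac ν μ)
  rw [memLp_two_iff_integrable_sq_norm hm]
  have h1 : Integrable (fun x => ‖f x‖ ^ 2) μ.1 :=
    (memLp_two_iff_integrable_sq_norm (Lp.aestronglyMeasurable f)).1 (Lp.memLp f)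
  refine ((integrable_toReal_rnDeriv_mul_iff (M.ac μ ν)).2 h1).congr ?_
  refine Filter.Eventually.of_forall fun x => ?_
  simp only [norm_mul, mul_pow, RCLike.norm_ofReal, abs_of_nonneg (Real.sqrt_nonneg _)]
  rw [Real.sq_sqrt ENNReal.toReal_nonneg]

/-- Every function `f ∈ L₂(μ)` gives an element `f √μ` of `L₂(M)`. -/
theorem incarnation_surjective (μ : M.carrier) :
    Function.Surjective (incarnation (𝕜 := 𝕜) μ) := by
  intro f
  refine ⟨⟨fun ν => (memLp_sqrt_mul μ ν f).toLp _, ?_⟩, ?_⟩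
  · intro κ ν
    filter_upwards [(memLp_sqrt_mul μ ν f).coeFn_toLp,
      (M.ac ν κ) (memLp_sqrt_mul μ κ f).coeFn_toLp,
      Measure.rnDeriv_mul_rnDeriv (κ := ν.1) (M.ac μ κ)] with x h1 h2 h3
    rw [h1, h2, ← h3, Pi.mul_apply, ENNReal.toReal_mul, Real.sqrt_mul ENNReal.toReal_nonneg]
    push_cast
    ring
  · refine Lp.ext ?_
    filter_upwards [(memLp_sqrt_mul μ μ f).coeFn_toLp, Measure.rnDeriv_self μ.1] with x h1 h2
    change ((memLp_sqrt_mul μ μ f).toLp _ : X → 𝕜) x = f x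
    rw [h1, h2]
    simp

/-- A measure of the class, used to fix an incarnation of `L₂(M)`. -/
def ref (M : MeasureClass X) : M.carrier := ⟨M.nonempty.some, M.nonempty.some_mem⟩

instance : NormedAddCommGroup (L2 𝕜 M) :=
  NormedAddCommGroup.induced (L2 𝕜 M) (Lp 𝕜 2 (ref M).1) (incarnation (ref M))
    (incarnation_injective _)

instance : InnerProductSpace 𝕜 (L2 𝕜 M) where
  toModule := inferInstanceAs (Module 𝕜 (L2 𝕜 M))
  norm_smul_le c ψ := by
    change ‖incarnation (ref M) (c • ψ)‖ ≤ ‖c‖ * ‖incarnation (ref M) ψ‖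
    rw [map_smul]
    exact norm_smul_le _ _
  inner ψ φ := inner 𝕜 (incarnation (ref M) ψ) (incarnation (ref M) φ)
  norm_sq_eq_re_inner ψ := norm_sq_eq_re_inner (incarnation (ref M) ψ)
  conj_inner_symm ψ φ := inner_conj_symm _ _
  add_left ψ φ χ := by simp only [map_add, inner_add_left]
  smul_left ψ φ c := by simp only [map_smul, inner_smul_left]

/-- The inner product of `L₂(M)` is that of `L₂(μ)`, for each measure `μ` of the class. -/
theorem inner_incarnation (μ : M.carrier) (ψ φ : L2 𝕜 M) :
    inner 𝕜 (incarnation μ ψ) (incarnation μ φ) = inner 𝕜 ψ φ := by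
  change _ = inner 𝕜 (incarnation (ref M) ψ) (incarnation (ref M) φ)
  rw [MeasureTheory.L2.inner_def, MeasureTheory.L2.inner_def,
    ← integral_rnDeriv_smul (M.ac (ref M) μ)]
  refine integral_congr_ae ?_
  filter_upwards [incarnation_eq ψ (ref M) μ, incarnation_eq φ (ref M) μ] with x h1 h2
  rw [h1, h2]
  simp only [RCLike.inner_apply, map_mul, RCLike.conj_ofReal, RCLike.real_smul_eq_coe_mul]
  have : (((ref M).1.rnDeriv μ.1 x).toReal : 𝕜) =
      (Real.sqrt ((ref M).1.rnDeriv μ.1 x).toReal : 𝕜) *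
        (Real.sqrt ((ref M).1.rnDeriv μ.1 x).toReal : 𝕜) := by
    rw [← RCLike.ofReal_mul, Real.mul_self_sqrt ENNReal.toReal_nonneg]
  rw [this]
  ring

/-- The canonical unitary operator from `L₂(M)` to `L₂(μ)`, for `μ ∈ M`. -/
def equivLp (μ : M.carrier) : L2 𝕜 M ≃ₗᵢ[𝕜] Lp 𝕜 2 μ.1 :=
  (LinearEquiv.ofBijective (incarnation μ)
    ⟨incarnation_injective μ, incarnation_surjective μ⟩).isometryOfInner
    (inner_incarnation μ)

@[simp]
theorem equivLp_apply (μ : M.carrier) (ψ : L2 𝕜 M) : equivLp μ ψ = incarnation μ ψ := rfl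

instance : CompleteSpace (L2 𝕜 M) :=
  ((equivLp (𝕜 := 𝕜) (ref M)).isometry.isUniformInducing.completeSpace_congr
    (equivLp (𝕜 := 𝕜) (ref M)).surjective).2 inferInstance

instance [MeasurableSpace.CountablyGenerated X] : SeparableSpace (L2 𝕜 M) := by
  have : Fact ((2 : ℝ≥0∞) ≠ ∞) := ⟨by simp⟩
  have : SecondCountableTopology (Lp 𝕜 2 (ref M).1) := inferInstance
  exact (equivLp (𝕜 := 𝕜) (ref M)).symm.surjective.denseRange.separableSpace
    (equivLp (𝕜 := 𝕜) (ref M)).symm.continuous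

theorem nontrivial (h : ∃ μ ∈ M.carrier, μ ≠ 0) : Nontrivial (L2 𝕜 M) := by
  obtain ⟨μ, hμ, h0⟩ := h
  have : IsFiniteMeasure μ := M.finite μ hμ
  have hne : indicatorConstLp 2 (μ := μ) MeasurableSet.univ (measure_ne_top _ _) (1 : 𝕜) ≠ 0 := by
    intro h
    rw [← norm_eq_zero, norm_indicatorConstLp (by simp) (by simp)] at h
    simp [Measure.real, ENNReal.toReal_eq_zero_iff] at h
    exact h0 h
  have : Nontrivial (Lp 𝕜 2 μ) := nontrivial_of_ne _ _ hne
  exact (equivLp (𝕜 := 𝕜) (M := M) ⟨μ, hμ⟩).symm.injective.nontrivial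

end L2

end MeasureClass
end

noncomputable section

open MeasureTheory TopologicalSpace
open scoped ENNReal TensorProduct

/-! ### Products of measure classes and tensor products of their Hilbert spaces -/

/-- The measurable maps `x ↦ (p x, q x)` and `j` are mutually inverse mod 0 isomorphisms between
the measure class `M` and the product of the measure classes `M₁` and `M₂`. -/
structure IsProduct {X X₁ X₂ : Type*} [MeasurableSpace X] [MeasurableSpace X₁]
    [MeasurableSpace X₂] (M₁ : MeasureClass X₁) (M₂ : MeasureClass X₂) (M : MeasureClass X)
    (p : X → X₁) (q : X → X₂) (j : X₁ × X₂ → X) : Prop where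
  measurable_p : Measurable p
  measurable_q : Measurable q
  measurable_j : Measurable j
  left_inv : ∀ x, j (p x, q x) = x
  right_inv : ∀ μ ∈ M₁.carrier, ∀ ν ∈ M₂.carrier, ∀ᵐ z ∂(μ.prod ν), (p (j z), q (j z)) = z
  map_mem : ∀ μ ∈ M₁.carrier, ∀ ν ∈ M₂.carrier, (μ.prod ν).map j ∈ M.carrier

namespace IsProduct

variable {X X₁ X₂ : Type*} [MeasurableSpace X] [MeasurableSpace X₁] [MeasurableSpace X₂]
  {M₁ : MeasureClass X₁} {M₂ : MeasureClass X₂} {M : MeasureClass X}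
  {p : X → X₁} {q : X → X₂} {j : X₁ × X₂ → X}

open MeasureClass MeasureClass.L2

/-- The product of a measure of `M₁` and a measure of `M₂`, viewed as a measure of `M`. -/
def prodMeasure (h : IsProduct M₁ M₂ M p q j) (μ : M₁.carrier) (ν : M₂.carrier) : M.carrier :=
  ⟨(μ.1.prod ν.1).map j, h.map_mem _ μ.2 _ ν.2⟩

variable (h : IsProduct M₁ M₂ M p q j)

theorem map_p_ac (μ : M₁.carrier) (ν : M₂.carrier) :
    (h.prodMeasure μ ν).1.map p ≪ μ.1 := by
  have : (h.prodMeasure μ ν).1.map p = (μ.1.prod ν.1).map Prod.fst := by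
    change ((μ.1.prod ν.1).map j).map p = _
    rw [Measure.map_map h.measurable_p h.measurable_j]
    refine Measure.map_congr ?_
    filter_upwards [h.right_inv _ μ.2 _ ν.2] with z hz using congrArg Prod.fst hz
  rw [this]
  exact Measure.quasiMeasurePreserving_fst.absolutelyContinuous

theorem map_q_ac (μ : M₁.carrier) (ν : M₂.carrier) :
    (h.prodMeasure μ ν).1.map q ≪ ν.1 := by
  have : (h.prodMeasure μ ν).1.map q = (μ.1.prod ν.1).map Prod.snd := by
    change ((μ.1.prod ν.1).map j).map q = _
    rw [Measure.map_map h.measurable_q h.measurable_j]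
    refine Measure.map_congr ?_
    filter_upwards [h.right_inv _ μ.2 _ ν.2] with z hz using congrArg Prod.snd hz
  rw [this]
  exact Measure.quasiMeasurePreserving_snd.absolutelyContinuous

theorem ae_p (μ : M₁.carrier) (ν : M₂.carrier) {P : X₁ → Prop} (hP : ∀ᵐ y ∂μ.1, P y) :
    ∀ᵐ x ∂(h.prodMeasure μ ν).1, P (p x) :=
  ae_of_ae_map h.measurable_p.aemeasurable (h.map_p_ac μ ν hP)

theorem ae_q (μ : M₁.carrier) (ν : M₂.carrier) {P : X₂ → Prop} (hP : ∀ᵐ y ∂ν.1, P y) :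
    ∀ᵐ x ∂(h.prodMeasure μ ν).1, P (q x) :=
  ae_of_ae_map h.measurable_q.aemeasurable (h.map_q_ac μ ν hP)

theorem aestronglyMeasurable_mul {𝕜 : Type*} [RCLike 𝕜] (μ : M₁.carrier) (ν : M₂.carrier)
    {f : X₁ → 𝕜} {g : X₂ → 𝕜}
    (hf : AEStronglyMeasurable f μ.1) (hg : AEStronglyMeasurable g ν.1) :
    AEStronglyMeasurable (fun x => f (p x) * g (q x)) (h.prodMeasure μ ν).1 :=
  ((hf.mono_ac (h.map_p_ac μ ν)).comp_measurable h.measurable_p).mul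
    ((hg.mono_ac (h.map_q_ac μ ν)).comp_measurable h.measurable_q)

theorem integral_mul {𝕜 : Type*} [RCLike 𝕜] (μ : M₁.carrier) (ν : M₂.carrier)
    {f : X₁ → 𝕜} {g : X₂ → 𝕜}
    (hf : AEStronglyMeasurable f μ.1) (hg : AEStronglyMeasurable g ν.1) :
    ∫ x, f (p x) * g (q x) ∂(h.prodMeasure μ ν).1 = (∫ y, f y ∂μ.1) * ∫ z, g z ∂ν.1 := by
  have hm := h.aestronglyMeasurable_mul μ ν hf hg
  change ∫ x, f (p x) * g (q x) ∂((μ.1.prod ν.1).map j) = _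
  rw [integral_map h.measurable_j.aemeasurable hm, ← integral_prod_mul]
  refine integral_congr_ae ?_
  filter_upwards [h.right_inv _ μ.2 _ ν.2] with z hz
  rw [Prod.ext_iff] at hz
  simp only at hz
  rw [hz.1, hz.2]

theorem memLp_mul {𝕜 : Type*} [RCLike 𝕜] (μ : M₁.carrier) (ν : M₂.carrier)
    {f : X₁ → 𝕜} {g : X₂ → 𝕜} (hf : MemLp f 2 μ.1) (hg : MemLp g 2 ν.1) :
    MemLp (fun x => f (p x) * g (q x)) 2 (h.prodMeasure μ ν).1 := by
  have hm := h.aestronglyMeasurable_mul μ ν hf.1 hg.1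
  rw [memLp_two_iff_integrable_sq_norm hm]
  have hm2 : AEStronglyMeasurable (fun x => ‖f (p x) * g (q x)‖ ^ 2)
      ((μ.1.prod ν.1).map j) := hm.norm.pow 2
  change Integrable _ ((μ.1.prod ν.1).map j)
  rw [integrable_map_measure hm2 h.measurable_j.aemeasurable]
  have h1 := (memLp_two_iff_integrable_sq_norm hf.1).1 hf
  have h2 := (memLp_two_iff_integrable_sq_norm hg.1).1 hg
  refine (h1.mul_prod h2).congr ?_
  filter_upwards [h.right_inv _ μ.2 _ ν.2] with z hz
  rw [Prod.ext_iff] at hz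
  simp only at hz
  simp only [Function.comp_apply]
  rw [hz.1, hz.2, norm_mul, mul_pow]

theorem rnDeriv_prodMeasure (μ μ₀ : M₁.carrier) (ν ν₀ : M₂.carrier) :
    (h.prodMeasure μ₀ ν₀).1.rnDeriv (h.prodMeasure μ ν).1 =ᵐ[(h.prodMeasure μ ν).1]
      fun x => μ₀.1.rnDeriv μ.1 (p x) * ν₀.1.rnDeriv ν.1 (q x) := by
  have hd : Measurable fun x => μ₀.1.rnDeriv μ.1 (p x) * ν₀.1.rnDeriv ν.1 (q x) :=
    ((Measure.measurable_rnDeriv _ _).comp h.measurable_p).mul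
      ((Measure.measurable_rnDeriv _ _).comp h.measurable_q)
  have key : (h.prodMeasure μ₀ ν₀).1 = (h.prodMeasure μ ν).1.withDensity
      fun x => μ₀.1.rnDeriv μ.1 (p x) * ν₀.1.rnDeriv ν.1 (q x) := by
    change (μ₀.1.prod ν₀.1).map j = ((μ.1.prod ν.1).map j).withDensity _
    conv_lhs => rw [← Measure.withDensity_rnDeriv_eq _ _ (M₁.ac μ₀ μ),
      ← Measure.withDensity_rnDeriv_eq _ _ (M₂.ac ν₀ ν)]
    rw [prod_withDensity (Measure.measurable_rnDeriv _ _) (Measure.measurable_rnDeriv _ _)]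
    ext s hs
    rw [Measure.map_apply h.measurable_j hs, withDensity_apply _ (h.measurable_j hs),
      withDensity_apply _ hs, setLIntegral_map hs hd h.measurable_j]
    refine lintegral_congr_ae (ae_restrict_of_ae ?_)
    filter_upwards [h.right_inv _ μ.2 _ ν.2] with z hz
    rw [Prod.ext_iff] at hz
    simp only at hz
    rw [hz.1, hz.2]
  rw [key]
  exact Measure.rnDeriv_withDensity _ hd

variable (𝕜 : Type*) [RCLike 𝕜]

/-- The multiplication `(f √μ, g √ν) ↦ (f ⊗ g) √(μ ⊗ ν)`. -/
def mulVec (ψ : L2 𝕜 M₁) (φ : L2 𝕜 M₂) : L2 𝕜 M :=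
  (equivLp (h.prodMeasure (ref M₁) (ref M₂))).symm
    ((h.memLp_mul (ref M₁) (ref M₂) (Lp.memLp (incarnation (ref M₁) ψ))
      (Lp.memLp (incarnation (ref M₂) φ))).toLp _)

/-- The multiplication does not depend on the choice of the incarnations. -/
theorem incarnation_mulVec (μ : M₁.carrier) (ν : M₂.carrier) (ψ : L2 𝕜 M₁) (φ : L2 𝕜 M₂) :
    (incarnation (h.prodMeasure μ ν) (h.mulVec 𝕜 ψ φ) : X → 𝕜) =ᵐ[(h.prodMeasure μ ν).1]
      fun x => incarnation μ ψ (p x) * incarnation ν φ (q x) := by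
  set ρ₀ := h.prodMeasure (ref M₁) (ref M₂) with hρ₀
  set ρ := h.prodMeasure μ ν with hρ
  have h0 : (incarnation ρ₀ (h.mulVec 𝕜 ψ φ) : X → 𝕜) =ᵐ[ρ₀.1]
      fun x => incarnation (ref M₁) ψ (p x) * incarnation (ref M₂) φ (q x) := by
    have : incarnation ρ₀ (h.mulVec 𝕜 ψ φ) =
        (h.memLp_mul (ref M₁) (ref M₂) (Lp.memLp (incarnation (ref M₁) ψ))
          (Lp.memLp (incarnation (ref M₂) φ))).toLp _ :=
      (equivLp ρ₀).apply_symm_apply _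
    rw [this]
    exact MemLp.coeFn_toLp _
  filter_upwards [incarnation_eq (h.mulVec 𝕜 ψ φ) ρ₀ ρ, M.ac ρ ρ₀ h0,
    h.rnDeriv_prodMeasure μ (ref M₁) ν (ref M₂),
    h.ae_p μ ν (incarnation_eq ψ (ref M₁) μ), h.ae_q μ ν (incarnation_eq φ (ref M₂) ν)]
    with x h1 h2 h3 h4 h5
  rw [h1, h2, h3, h4, h5, ENNReal.toReal_mul, Real.sqrt_mul ENNReal.toReal_nonneg]
  push_cast
  ring

/-- The multiplication `(f √μ, g √ν) ↦ (f ⊗ g) √(μ ⊗ ν)`, as a bilinear map. -/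
def mul : L2 𝕜 M₁ →ₗ[𝕜] L2 𝕜 M₂ →ₗ[𝕜] L2 𝕜 M :=
  LinearMap.mk₂ 𝕜 (h.mulVec 𝕜)
    (by
      intro ψ ψ' φ
      refine incarnation_injective (h.prodMeasure (ref M₁) (ref M₂)) (Lp.ext ?_)
      rw [map_add]
      filter_upwards [h.incarnation_mulVec 𝕜 (ref M₁) (ref M₂) (ψ + ψ') φ,
        h.incarnation_mulVec 𝕜 (ref M₁) (ref M₂) ψ φ,
        h.incarnation_mulVec 𝕜 (ref M₁) (ref M₂) ψ' φ,
        Lp.coeFn_add (incarnation (h.prodMeasure (ref M₁) (ref M₂)) (h.mulVec 𝕜 ψ φ))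
          (incarnation (h.prodMeasure (ref M₁) (ref M₂)) (h.mulVec 𝕜 ψ' φ)),
        h.ae_p (ref M₁) (ref M₂)
          (Lp.coeFn_add (incarnation (ref M₁) ψ) (incarnation (ref M₁) ψ'))]
        with x h1 h2 h3 h4 h5
      rw [h1, h4, Pi.add_apply, h2, h3, map_add, h5, Pi.add_apply, add_mul])
    (by
      intro c ψ φ
      refine incarnation_injective (h.prodMeasure (ref M₁) (ref M₂)) (Lp.ext ?_)
      rw [map_smul]
      filter_upwards [h.incarnation_mulVec 𝕜 (ref M₁) (ref M₂) (c • ψ) φ,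
        h.incarnation_mulVec 𝕜 (ref M₁) (ref M₂) ψ φ,
        Lp.coeFn_smul c (incarnation (h.prodMeasure (ref M₁) (ref M₂)) (h.mulVec 𝕜 ψ φ)),
        h.ae_p (ref M₁) (ref M₂) (Lp.coeFn_smul c (incarnation (ref M₁) ψ))]
        with x h1 h2 h3 h4
      rw [h1, h3, Pi.smul_apply, h2, map_smul, h4, Pi.smul_apply, smul_mul_assoc])
    (by
      intro ψ φ φ'
      refine incarnation_injective (h.prodMeasure (ref M₁) (ref M₂)) (Lp.ext ?_)
      rw [map_add]
      filter_upwards [h.incarnation_mulVec 𝕜 (ref M₁) (ref M₂) ψ (φ + φ'),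
        h.incarnation_mulVec 𝕜 (ref M₁) (ref M₂) ψ φ,
        h.incarnation_mulVec 𝕜 (ref M₁) (ref M₂) ψ φ',
        Lp.coeFn_add (incarnation (h.prodMeasure (ref M₁) (ref M₂)) (h.mulVec 𝕜 ψ φ))
          (incarnation (h.prodMeasure (ref M₁) (ref M₂)) (h.mulVec 𝕜 ψ φ')),
        h.ae_q (ref M₁) (ref M₂)
          (Lp.coeFn_add (incarnation (ref M₂) φ) (incarnation (ref M₂) φ'))]
        with x h1 h2 h3 h4 h5
      rw [h1, h4, Pi.add_apply, h2, h3, map_add, h5, Pi.add_apply, mul_add])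
    (by
      intro c ψ φ
      refine incarnation_injective (h.prodMeasure (ref M₁) (ref M₂)) (Lp.ext ?_)
      rw [map_smul]
      filter_upwards [h.incarnation_mulVec 𝕜 (ref M₁) (ref M₂) ψ (c • φ),
        h.incarnation_mulVec 𝕜 (ref M₁) (ref M₂) ψ φ,
        Lp.coeFn_smul c (incarnation (h.prodMeasure (ref M₁) (ref M₂)) (h.mulVec 𝕜 ψ φ)),
        h.ae_q (ref M₁) (ref M₂) (Lp.coeFn_smul c (incarnation (ref M₂) φ))]
        with x h1 h2 h3 h4
      rw [h1, h3, Pi.smul_apply, h2, map_smul, h4, Pi.smul_apply, mul_smul_comm])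

theorem incarnation_mul (μ : M₁.carrier) (ν : M₂.carrier) (ψ : L2 𝕜 M₁) (φ : L2 𝕜 M₂) :
    (incarnation (h.prodMeasure μ ν) (h.mul 𝕜 ψ φ) : X → 𝕜) =ᵐ[(h.prodMeasure μ ν).1]
      fun x => incarnation μ ψ (p x) * incarnation ν φ (q x) :=
  h.incarnation_mulVec 𝕜 μ ν ψ φ

theorem inner_mul (ψ ψ' : L2 𝕜 M₁) (φ φ' : L2 𝕜 M₂) :
    inner 𝕜 (h.mul 𝕜 ψ φ) (h.mul 𝕜 ψ' φ') = inner 𝕜 ψ ψ' * inner 𝕜 φ φ' := by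
  rw [← inner_incarnation (h.prodMeasure (ref M₁) (ref M₂)), ← inner_incarnation (ref M₁),
    ← inner_incarnation (ref M₂), MeasureTheory.L2.inner_def, MeasureTheory.L2.inner_def,
    MeasureTheory.L2.inner_def, ← h.integral_mul (ref M₁) (ref M₂)
      ((Lp.aestronglyMeasurable _).inner (Lp.aestronglyMeasurable _))
      ((Lp.aestronglyMeasurable _).inner (Lp.aestronglyMeasurable _))]
  refine integral_congr_ae ?_
  filter_upwards [h.incarnation_mul 𝕜 (ref M₁) (ref M₂) ψ φ,
    h.incarnation_mul 𝕜 (ref M₁) (ref M₂) ψ' φ'] with x h1 h2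
  rw [h1, h2]
  simp only [RCLike.inner_apply, map_mul]
  ring

/-- The products of vectors span a dense subspace. -/
theorem span_mul_dense :
    (Submodule.span 𝕜 (Set.range fun z : L2 𝕜 M₁ × L2 𝕜 M₂ => h.mul 𝕜 z.1 z.2)).topologicalClosure
      = ⊤ := by
  rw [Submodule.topologicalClosure_eq_top_iff, Submodule.eq_bot_iff]
  intro χ hχ
  rw [Submodule.mem_orthogonal] at hχ
  set ρ := h.prodMeasure (ref M₁) (ref M₂) with hρ
  have hint : Integrable (incarnation ρ χ) ρ.1 :=
    (Lp.memLp (incarnation ρ χ)).integrable (by norm_num)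
  have hpq : Measurable fun x => (p x, q x) := h.measurable_p.prodMk h.measurable_q
  have key : ∀ T : Set (X₁ × X₂), MeasurableSet T →
      ∫ x in (fun x => (p x, q x)) ⁻¹' T, incarnation ρ χ x ∂ρ.1 = 0 := by
    have hrect : ∀ (A : Set X₁) (B : Set X₂), MeasurableSet A → MeasurableSet B →
        ∫ x in (fun x => (p x, q x)) ⁻¹' (A ×ˢ B), incarnation ρ χ x ∂ρ.1 = 0 := by
      intro A B hA hB
      set a : L2 𝕜 M₁ := (equivLp (ref M₁)).symm
        (indicatorConstLp 2 hA (measure_ne_top _ _) (1 : 𝕜)) with ha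
      set b : L2 𝕜 M₂ := (equivLp (ref M₂)).symm
        (indicatorConstLp 2 hB (measure_ne_top _ _) (1 : 𝕜)) with hb
      have ha' : incarnation (ref M₁) a = indicatorConstLp 2 hA (measure_ne_top _ _) (1 : 𝕜) :=
        (equivLp (ref M₁)).apply_symm_apply _
      have hb' : incarnation (ref M₂) b = indicatorConstLp 2 hB (measure_ne_top _ _) (1 : 𝕜) :=
        (equivLp (ref M₂)).apply_symm_apply _
      have h0 := hχ _ (Submodule.subset_span ⟨(a, b), rfl⟩)
      rw [← inner_incarnation ρ, MeasureTheory.L2.inner_def] at h0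
      rw [← integral_indicator (hpq (hA.prod hB)), ← h0]
      refine integral_congr_ae ?_
      filter_upwards [h.incarnation_mul 𝕜 (ref M₁) (ref M₂) a b,
        h.ae_p (ref M₁) (ref M₂) (ha' ▸ indicatorConstLp_coeFn :
          (incarnation (ref M₁) a : X₁ → 𝕜) =ᵐ[(ref M₁).1] A.indicator fun _ => 1),
        h.ae_q (ref M₁) (ref M₂) (hb' ▸ indicatorConstLp_coeFn :
          (incarnation (ref M₂) b : X₂ → 𝕜) =ᵐ[(ref M₂).1] B.indicator fun _ => 1)]
        with x h1 h2 h3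
      simp only [RCLike.inner_apply]
      rw [h1, h2, h3]
      by_cases hxA : p x ∈ A <;> by_cases hxB : q x ∈ B <;>
        simp [Set.indicator, hxA, hxB]
    intro T hT
    induction T, hT using MeasurableSpace.induction_on_inter generateFrom_prod.symm
      isPiSystem_prod with
    | empty => simp
    | basic T hT =>
      obtain ⟨A, hA, B, hB, rfl⟩ := hT
      exact hrect A B hA hB
    | compl T hT ih =>
      have huniv := hrect Set.univ Set.univ MeasurableSet.univ MeasurableSet.univ
      rw [Set.univ_prod_univ, Set.preimage_univ, setIntegral_univ] at huniv
      rw [Set.preimage_compl, setIntegral_compl (hpq hT) hint, ih, huniv, sub_zero]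
    | iUnion f hd hm ih =>
      rw [Set.preimage_iUnion, integral_iUnion (fun i => hpq (hm i))
        (fun i k hik => (hd hik).preimage _) hint.integrableOn]
      simp [ih]
  have hzero : incarnation ρ χ = 0 := by
    refine Lp.ext ?_
    refine (?_ : (incarnation ρ χ : X → 𝕜) =ᵐ[ρ.1] 0).trans (Lp.coeFn_zero _ _ _).symm
    refine Lp.ae_eq_zero_of_forall_setIntegral_eq_zero _ (by norm_num) (by norm_num)
      (fun s _ _ => hint.integrableOn) (fun s hs _ => ?_)
    have hs' : s = (fun x => (p x, q x)) ⁻¹' (j ⁻¹' s) := by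
      ext x
      simp [h.left_inv x]
    rw [hs']
    exact key _ (h.measurable_j hs)
  exact incarnation_injective ρ (by rw [hzero, map_zero])

end IsProduct

/-- The tensor product of two Hilbert spaces: the completion of the algebraic tensor product,
for the inner product with `⟪x ⊗ y, x' ⊗ y'⟫ = ⟪x, x'⟫ ⟪y, y'⟫`. -/
abbrev HilbertTensor (𝕜 : Type*) [RCLike 𝕜] (E F : Type*) [NormedAddCommGroup E]
    [InnerProductSpace 𝕜 E] [NormedAddCommGroup F] [InnerProductSpace 𝕜 F] : Type _ :=
  UniformSpace.Completion (E ⊗[𝕜] F)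

/-- The vector `x ⊗ y` of the tensor product of two Hilbert spaces. -/
def htmul (𝕜 : Type*) [RCLike 𝕜] {E F : Type*} [NormedAddCommGroup E]
    [InnerProductSpace 𝕜 E] [NormedAddCommGroup F] [InnerProductSpace 𝕜 F] (x : E) (y : F) :
    HilbertTensor 𝕜 E F :=
  ((x ⊗ₜ[𝕜] y : E ⊗[𝕜] F) : UniformSpace.Completion (E ⊗[𝕜] F))

section lift

variable {𝕜 : Type*} [RCLike 𝕜] {E F G : Type*} [NormedAddCommGroup E]
  [InnerProductSpace 𝕜 E] [NormedAddCommGroup F] [InnerProductSpace 𝕜 F]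
  [NormedAddCommGroup G] [InnerProductSpace 𝕜 G]

theorem inner_lift (B : E →ₗ[𝕜] F →ₗ[𝕜] G)
    (hB : ∀ x x' y y', inner 𝕜 (B x y) (B x' y') = inner 𝕜 x x' * inner 𝕜 y y')
    (z w : E ⊗[𝕜] F) :
    inner 𝕜 (TensorProduct.lift B z) (TensorProduct.lift B w) = inner 𝕜 z w := by
  induction z using TensorProduct.induction_on with
  | zero => simp
  | add z z' hz hz' => rw [map_add, inner_add_left, inner_add_left, hz, hz']
  | tmul x y =>
    induction w using TensorProduct.induction_on with
    | zero => simp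
    | add w w' hw hw' => rw [map_add, inner_add_right, inner_add_right, hw, hw']
    | tmul x' y' => simp [hB]

/-- A bilinear map that multiplies inner products and whose values span a dense subspace gives a
unitary operator on the tensor product of Hilbert spaces. -/
def unitaryOfBilin [CompleteSpace G] (B : E →ₗ[𝕜] F →ₗ[𝕜] G)
    (hB : ∀ x x' y y', inner 𝕜 (B x y) (B x' y') = inner 𝕜 x x' * inner 𝕜 y y')
    (hd : (Submodule.span 𝕜 (Set.range fun z : E × F => B z.1 z.2)).topologicalClosure = ⊤) :
    HilbertTensor 𝕜 E F ≃ₗᵢ[𝕜] G :=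
  (LinearEquiv.refl 𝕜 (E ⊗[𝕜] F)).extendOfIsometry
    (UniformSpace.Completion.toComplₗᵢ (𝕜 := 𝕜) (E := E ⊗[𝕜] F)).toLinearMap
    (TensorProduct.lift B)
    UniformSpace.Completion.denseRange_coe
    (by
      have h1 : Submodule.span 𝕜 (Set.range fun z : E × F => B z.1 z.2) ≤
          LinearMap.range (TensorProduct.lift B) := by
        refine Submodule.span_le.2 ?_
        rintro _ ⟨z, rfl⟩
        exact ⟨z.1 ⊗ₜ z.2, by simp⟩
      have h2 := Submodule.dense_iff_topologicalClosure_eq_top.2 hd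
      exact h2.mono h1)
    (by
      intro z
      have h1 : ‖TensorProduct.lift B z‖ = ‖z‖ := by
        rw [@norm_eq_sqrt_re_inner 𝕜, @norm_eq_sqrt_re_inner 𝕜, inner_lift B hB]
      simpa using h1)

@[simp]
theorem unitaryOfBilin_htmul [CompleteSpace G] (B : E →ₗ[𝕜] F →ₗ[𝕜] G)
    (hB : ∀ x x' y y', inner 𝕜 (B x y) (B x' y') = inner 𝕜 x x' * inner 𝕜 y y')
    (hd : (Submodule.span 𝕜 (Set.range fun z : E × F => B z.1 z.2)).topologicalClosure = ⊤)
    (x : E) (y : F) :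
    unitaryOfBilin B hB hd (htmul 𝕜 x y) = B x y := by
  refine (LinearEquiv.extendOfIsometry_eq (LinearEquiv.refl 𝕜 (E ⊗[𝕜] F))
    (UniformSpace.Completion.toComplₗᵢ (𝕜 := 𝕜) (E := E ⊗[𝕜] F)).toLinearMap
    (TensorProduct.lift B) _ _ _ (x ⊗ₜ y)).trans ?_
  simp

end lift
end

noncomputable section

open MeasureTheory TopologicalSpace
open scoped ENNReal

/-! ### Continuous products of Hilbert spaces over the unit interval -/

/-- A continuous product of Hilbert spaces over `[0, 1]`: separable Hilbert spaces `H_{s,t}` of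
nonzero dimension, for `0 ≤ s < t ≤ 1`, and unitary operators
`W_{r,s,t} : H_{r,s} ⊗ H_{s,t} → H_{r,t}` that are associative. Commutativity of the diagram
of associativity is stated for the vectors `x ⊗ y ⊗ z`, which span a dense subspace. -/
structure CPHS.{u, v} (𝕜 : Type u) [RCLike 𝕜] where
  H : ∀ {s t : unitInterval}, s < t → Type v
  [normed : ∀ {s t : unitInterval} (h : s < t), NormedAddCommGroup (H h)]
  [innerProduct : ∀ {s t : unitInterval} (h : s < t), InnerProductSpace 𝕜 (H h)]
  [complete : ∀ {s t : unitInterval} (h : s < t), CompleteSpace (H h)]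
  [separable : ∀ {s t : unitInterval} (h : s < t), SeparableSpace (H h)]
  [nontrivial : ∀ {s t : unitInterval} (h : s < t), Nontrivial (H h)]
  W : ∀ {r s t : unitInterval} (hrs : r < s) (hst : s < t),
    HilbertTensor 𝕜 (H hrs) (H hst) ≃ₗᵢ[𝕜] H (hrs.trans hst)
  assoc : ∀ {r s t u : unitInterval} (hrs : r < s) (hst : s < t) (htu : t < u)
    (x : H hrs) (y : H hst) (z : H htu),
    W (hrs.trans hst) htu (htmul 𝕜 (W hrs hst (htmul 𝕜 x y)) z) =
      W hrs (hst.trans htu) (htmul 𝕜 x (W hst htu (htmul 𝕜 y z)))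

namespace CPHS

attribute [instance] CPHS.normed CPHS.innerProduct CPHS.complete CPHS.separable CPHS.nontrivial

/-- An isomorphism of continuous products of Hilbert spaces over `[0, 1]`: unitary operators
`U_{s,t} : H_{s,t} → H'_{s,t}` such that `U_{r,t} W_{r,s,t} = W'_{r,s,t} (U_{r,s} ⊗ U_{s,t})`.
The equality is stated for the vectors `x ⊗ y`, which span a dense subspace. -/
structure Iso {𝕜 : Type*} [RCLike 𝕜] (P P' : CPHS 𝕜) where
  U : ∀ {s t : unitInterval} (h : s < t), P.H h ≃ₗᵢ[𝕜] P'.H h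
  comm : ∀ {r s t : unitInterval} (hrs : r < s) (hst : s < t) (x : P.H hrs) (y : P.H hst),
    U (hrs.trans hst) (P.W hrs hst (htmul 𝕜 x y)) =
      P'.W hrs hst (htmul 𝕜 (U hrs x) (U hst y))

end CPHS

/-! ### Random closed sets -/

/-- The space of closed subsets of `[s, t]`, with the Effros σ-field. -/
abbrev ClosedIn (s t : ℝ) : Type := {C : Closeds ℝ // (C : Set ℝ) ⊆ Set.Icc s t}

/-- The closed interval `[s, t]`, as an element of the space of closed sets. -/
def iccClosed (s t : ℝ) : Closeds ℝ := ⟨Set.Icc s t, isClosed_Icc⟩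

/-- The map `C ↦ C ∩ [s, t]`. -/
def cut (s t : ℝ) (C : Closeds ℝ) : ClosedIn s t :=
  ⟨C ⊓ iccClosed s t, Set.inter_subset_right⟩

theorem measurable_cut (s t : ℝ) : Measurable (cut s t) :=
  (Effros.measurable_inf _).subtype_mk

/-- The map `(A, B) ↦ A ∪ B`. -/
def glue {r s t : ℝ} (hrs : r ≤ s) (hst : s ≤ t) (P : ClosedIn r s × ClosedIn s t) :
    ClosedIn r t :=
  ⟨P.1.1 ⊔ P.2.1, Set.union_subset (P.1.2.trans (Set.Icc_subset_Icc_right hst))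
    (P.2.2.trans (Set.Icc_subset_Icc_left hrs))⟩

theorem measurable_glue {r s t : ℝ} (hrs : r ≤ s) (hst : s ≤ t) : Measurable (glue hrs hst) :=
  (Effros.measurable_sup.comp ((measurable_subtype_coe.comp measurable_fst).prodMk
    (measurable_subtype_coe.comp measurable_snd))).subtype_mk

theorem glue_cut {r s t : ℝ} (hrs : r ≤ s) (hst : s ≤ t) (C : Closeds ℝ) :
    glue hrs hst (cut r s C, cut s t C) = cut r t C := by
  refine Subtype.ext (SetLike.coe_injective ?_)
  change ((C : Set ℝ) ∩ Set.Icc r s) ∪ ((C : Set ℝ) ∩ Set.Icc s t) = (C : Set ℝ) ∩ Set.Icc r t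
  rw [← Set.inter_union_distrib_left, Set.Icc_union_Icc_eq_Icc hrs hst]

theorem cut_eq_self {s t : ℝ} (C : ClosedIn s t) : cut s t C.1 = C :=
  Subtype.ext (SetLike.coe_injective (Set.inter_eq_left.2 C.2))

theorem cut_glue_left {r s t : ℝ} (hrs : r ≤ s) (hst : s ≤ t)
    (P : ClosedIn r s × ClosedIn s t) (hs : s ∉ P.2.1) :
    cut r s (glue hrs hst P).1 = P.1 := by
  refine Subtype.ext (SetLike.coe_injective (Set.ext fun x => ?_))
  change ((x ∈ P.1.1 ∨ x ∈ P.2.1) ∧ x ∈ Set.Icc r s) ↔ x ∈ P.1.1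
  constructor
  · rintro ⟨h1 | h2, h3⟩
    · exact h1
    · have : x = s := le_antisymm h3.2 (P.2.2 h2).1
      exact absurd (this ▸ h2) hs
  · intro h1
    exact ⟨Or.inl h1, P.1.2 h1⟩

theorem cut_glue_right {r s t : ℝ} (hrs : r ≤ s) (hst : s ≤ t)
    (P : ClosedIn r s × ClosedIn s t) (hs : s ∉ P.1.1) :
    cut s t (glue hrs hst P).1 = P.2 := by
  refine Subtype.ext (SetLike.coe_injective (Set.ext fun x => ?_))
  change ((x ∈ P.1.1 ∨ x ∈ P.2.1) ∧ x ∈ Set.Icc s t) ↔ x ∈ P.2.1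
  constructor
  · rintro ⟨h1 | h2, h3⟩
    · have : x = s := le_antisymm (P.1.2 h1).2 h3.1
      exact absurd (this ▸ h1) hs
    · exact h2
  · intro h1
    exact ⟨Or.inr h1, P.2.2 h1⟩

/-- The sub-σ-field generated by the map `C ↦ C ∩ F`. -/
abbrev effrosOn (F : Closeds ℝ) : MeasurableSpace (Closeds ℝ) :=
  MeasurableSpace.comap (fun C => C ⊓ F) Effros.effros

theorem comap_cut_le {s t : ℝ} {F : Closeds ℝ} (h : Set.Icc s t ⊆ (F : Set ℝ)) :
    MeasurableSpace.comap (cut s t) inferInstance ≤ effrosOn F := by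
  have : cut s t = cut s t ∘ fun C => C ⊓ F := by
    funext C
    refine Subtype.ext (SetLike.coe_injective ?_)
    change (C : Set ℝ) ∩ Set.Icc s t = ((C : Set ℝ) ∩ (F : Set ℝ)) ∩ Set.Icc s t
    rw [Set.inter_assoc, Set.inter_eq_right.2 h]
  rw [this, ← MeasurableSpace.comap_comp]
  exact MeasurableSpace.comap_mono (measurable_iff_comap_le.1 (measurable_cut s t))

namespace MeasureClass

/-- An equivalence class of measures on the space of closed subsets of the line is decomposable
if, for each `s`, the σ-fields generated by `C ↦ C ∩ (-∞, s]` and by `C ↦ C ∩ [s, ∞)` are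
independent, and, for each `t`, almost no set contains `t`. -/
structure IsDecomposable (M : MeasureClass (Closeds ℝ)) : Prop where
  independent : ∀ s : ℝ, Independent (effrosOn ⟨Set.Iic s, isClosed_Iic⟩)
    (effrosOn ⟨Set.Ici s, isClosed_Ici⟩) M
  negligible : ∀ t : ℝ, M.Negligible {C | t ∈ C}

/-- The image of an equivalence class of measures under the map `C ↦ C ∩ [s, t]`. -/
def cutClass (M : MeasureClass (Closeds ℝ)) (s t : ℝ) : MeasureClass (ClosedIn s t) :=
  M.map (cut s t) (measurable_cut s t)

namespace IsDecomposable

variable {M : MeasureClass (Closeds ℝ)}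

theorem ae_notMem (hM : M.IsDecomposable) (s t x : ℝ) :
    (M.cutClass s t).AlmostAll fun C => x ∉ C.1 := by
  rintro _ ⟨μ, hμ, rfl⟩
  have hmeas : MeasurableSet {C : ClosedIn s t | x ∉ C.1} :=
    measurable_subtype_coe (Effros.measurableSet_mem x).compl
  refine (ae_map_iff (measurable_cut s t).aemeasurable hmeas).2 ?_
  have h0 : ∀ᵐ C ∂μ, C ∉ {C : Closeds ℝ | x ∈ C} :=
    measure_eq_zero_iff_ae_notMem.1 (hM.negligible x μ hμ)
  filter_upwards [h0] with C hC h
  exact hC h.1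

theorem isProduct (hM : M.IsDecomposable) {r s t : ℝ} (hrs : r ≤ s) (hst : s ≤ t) :
    IsProduct (M.cutClass r s) (M.cutClass s t) (M.cutClass r t)
      (fun C => cut r s C.1) (fun C => cut s t C.1) (glue hrs hst) where
  measurable_p := (measurable_cut r s).comp measurable_subtype_coe
  measurable_q := (measurable_cut s t).comp measurable_subtype_coe
  measurable_j := measurable_glue hrs hst
  left_inv C := by rw [glue_cut, cut_eq_self]
  right_inv μ hμ ν hν := by
    have := (M.cutClass r s).finite μ hμ
    have := (M.cutClass s t).finite ν hν
    have h1 : ∀ᵐ z ∂(μ.prod ν), s ∉ z.1.1 :=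
      Measure.quasiMeasurePreserving_fst.ae (hM.ae_notMem r s s μ hμ)
    have h2 : ∀ᵐ z ∂(μ.prod ν), s ∉ z.2.1 :=
      Measure.quasiMeasurePreserving_snd.ae (hM.ae_notMem s t s ν hν)
    filter_upwards [h1, h2] with z hz1 hz2
    exact Prod.ext (cut_glue_left hrs hst z hz2) (cut_glue_right hrs hst z hz1)
  map_mem μ hμ ν hν := by
    have := (M.cutClass r s).finite μ hμ
    have := (M.cutClass s t).finite ν hν
    obtain ⟨π, hπ, hprob, hind⟩ := hM.independent s
    have hind' : ProbabilityTheory.IndepFun (cut r s) (cut s t) π :=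
      ProbabilityTheory.indep_of_indep_of_le_right
        (ProbabilityTheory.indep_of_indep_of_le_left hind
          (comap_cut_le Set.Icc_subset_Iic_self))
        (comap_cut_le Set.Icc_subset_Ici_self)
    have hprod := hind'.map_prod_eq_prod_map_map (measurable_cut r s).aemeasurable
      (measurable_cut s t).aemeasurable
    have hglue : ((π.map (cut r s)).prod (π.map (cut s t))).map (glue hrs hst) =
        π.map (cut r t) := by
      rw [← hprod, Measure.map_map (measurable_glue hrs hst)
        ((measurable_cut r s).prodMk (measurable_cut s t))]
      congr 1
      funext C
      exact glue_cut hrs hst C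
    have hπr : π.map (cut r s) ∈ (M.cutClass r s).carrier := ⟨π, hπ, rfl⟩
    have hπs : π.map (cut s t) ∈ (M.cutClass s t).carrier := ⟨π, hπ, rfl⟩
    have hπt : π.map (cut r t) ∈ (M.cutClass r t).carrier := ⟨π, hπ, rfl⟩
    obtain ⟨a1, a2⟩ := ((M.cutClass r s).mem_iff _ hπr μ inferInstance).1 hμ
    obtain ⟨b1, b2⟩ := ((M.cutClass s t).mem_iff _ hπs ν inferInstance).1 hν
    refine ((M.cutClass r t).mem_iff _ hπt _
      (Measure.isFiniteMeasure_map _ _)).2 ?_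
    rw [← hglue]
    exact ⟨(a1.prod b1).map (measurable_glue hrs hst), (a2.prod b2).map (measurable_glue hrs hst)⟩

theorem nontrivial_L2 (𝕜 : Type*) [RCLike 𝕜] (hM : M.IsDecomposable) (s t : ℝ) :
    Nontrivial (L2 𝕜 (M.cutClass s t)) := by
  obtain ⟨π, hπ, hprob, -⟩ := hM.independent 0
  refine L2.nontrivial ⟨π.map (cut s t), ⟨π, hπ, rfl⟩, ?_⟩
  have := Measure.isProbabilityMeasure_map (μ := π) (measurable_cut s t).aemeasurable
  exact IsProbabilityMeasure.ne_zero _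

theorem mul_assoc (𝕜 : Type*) [RCLike 𝕜] (hM : M.IsDecomposable) {r s t u : ℝ}
    (hrs : r ≤ s) (hst : s ≤ t) (htu : t ≤ u) (x : L2 𝕜 (M.cutClass r s))
    (y : L2 𝕜 (M.cutClass s t)) (z : L2 𝕜 (M.cutClass t u)) :
    (hM.isProduct (hrs.trans hst) htu).mul 𝕜 ((hM.isProduct hrs hst).mul 𝕜 x y) z =
      (hM.isProduct hrs (hst.trans htu)).mul 𝕜 x ((hM.isProduct hst htu).mul 𝕜 y z) := by
  set μ := L2.ref (M.cutClass r s)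
  set ν := L2.ref (M.cutClass s t)
  set κ := L2.ref (M.cutClass t u)
  set h1 := hM.isProduct hrs hst
  set h2 := hM.isProduct (hrs.trans hst) htu
  set h3 := hM.isProduct hst htu
  set h4 := hM.isProduct hrs (hst.trans htu)
  have hρ : h2.prodMeasure (h1.prodMeasure μ ν) κ = h4.prodMeasure μ (h3.prodMeasure ν κ) := by
    refine Subtype.ext ?_
    change (((μ.1.prod ν.1).map (glue hrs hst)).prod κ.1).map (glue (hrs.trans hst) htu) =
      (μ.1.prod ((ν.1.prod κ.1).map (glue hst htu))).map (glue hrs (hst.trans htu))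
    have e1 : ((μ.1.prod ν.1).map (glue hrs hst)).prod κ.1 =
        ((μ.1.prod ν.1).prod κ.1).map (Prod.map (glue hrs hst) id) := by
      rw [← Measure.map_prod_map _ _ (measurable_glue hrs hst) measurable_id, Measure.map_id]
    have e2 : μ.1.prod ((ν.1.prod κ.1).map (glue hst htu)) =
        (μ.1.prod (ν.1.prod κ.1)).map (Prod.map id (glue hst htu)) := by
      rw [← Measure.map_prod_map _ _ measurable_id (measurable_glue hst htu), Measure.map_id]
    rw [e1, e2, ← Measure.prodAssoc_prod, Measure.map_map (measurable_glue _ _)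
      ((measurable_glue hrs hst).prodMap measurable_id),
      Measure.map_map (measurable_glue _ _) (measurable_id.prodMap (measurable_glue hst htu)),
      Measure.map_map ((measurable_glue _ _).comp
        (measurable_id.prodMap (measurable_glue hst htu))) MeasurableEquiv.prodAssoc.measurable]
    congr 1
    funext z
    refine Subtype.ext ?_
    exact sup_assoc _ _ _
  refine L2.incarnation_injective (h4.prodMeasure μ (h3.prodMeasure ν κ)) (Lp.ext ?_)
  have hL := h2.incarnation_mul 𝕜 (h1.prodMeasure μ ν) κ (h1.mul 𝕜 x y) z
  have hL' := h2.ae_p (h1.prodMeasure μ ν) κ (h1.incarnation_mul 𝕜 μ ν x y)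
  rw [hρ] at hL hL'
  filter_upwards [hL, hL', h4.incarnation_mul 𝕜 μ (h3.prodMeasure ν κ) x (h3.mul 𝕜 y z),
    h4.ae_q μ (h3.prodMeasure ν κ) (h3.incarnation_mul 𝕜 ν κ y z)] with C c1 c2 c3 c4
  have d1 : cut r s (cut r t C.1).1 = cut r s C.1 := by
    refine Subtype.ext (SetLike.coe_injective ?_)
    change ((C.1 : Set ℝ) ∩ Set.Icc r t) ∩ Set.Icc r s = (C.1 : Set ℝ) ∩ Set.Icc r s
    rw [Set.inter_assoc, Set.inter_eq_right.2 (Set.Icc_subset_Icc_right hst)]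
  have d2 : cut s t (cut r t C.1).1 = cut s t C.1 := by
    refine Subtype.ext (SetLike.coe_injective ?_)
    change ((C.1 : Set ℝ) ∩ Set.Icc r t) ∩ Set.Icc s t = (C.1 : Set ℝ) ∩ Set.Icc s t
    rw [Set.inter_assoc, Set.inter_eq_right.2 (Set.Icc_subset_Icc_left hrs)]
  have d3 : cut s t (cut s u C.1).1 = cut s t C.1 := by
    refine Subtype.ext (SetLike.coe_injective ?_)
    change ((C.1 : Set ℝ) ∩ Set.Icc s u) ∩ Set.Icc s t = (C.1 : Set ℝ) ∩ Set.Icc s t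
    rw [Set.inter_assoc, Set.inter_eq_right.2 (Set.Icc_subset_Icc_right htu)]
  have d4 : cut t u (cut s u C.1).1 = cut t u C.1 := by
    refine Subtype.ext (SetLike.coe_injective ?_)
    change ((C.1 : Set ℝ) ∩ Set.Icc s u) ∩ Set.Icc t u = (C.1 : Set ℝ) ∩ Set.Icc t u
    rw [Set.inter_assoc, Set.inter_eq_right.2 (Set.Icc_subset_Icc_left hst)]
  rw [c1, c2, c3, c4, d1, d2, d3, d4, _root_.mul_assoc]

/-- The continuous product of Hilbert spaces `H_{s,t} = L₂(M_{s,t})`, `0 ≤ s < t ≤ 1`, given by a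
decomposable equivalence class `M` of measures, where `M_{s,t}` is the image of `M` under the map
`C ↦ C ∩ [s, t]`. The operator `W_{r,s,t}` sends `(f √μ) ⊗ (g √ν)` to `(f ⊗ g) √(μ ⊗ ν)`, where
`M_{r,t}` is identified with `M_{r,s} × M_{s,t}` through `C ↦ (C ∩ [r, s], C ∩ [s, t])`. -/
def cphs (𝕜 : Type*) [RCLike 𝕜] (hM : M.IsDecomposable) : CPHS 𝕜 where
  H {s t} _ := L2 𝕜 (M.cutClass s t)
  nontrivial {s t} _ := hM.nontrivial_L2 𝕜 s t
  W {_ _ _} hrs hst := unitaryOfBilin ((hM.isProduct hrs.le hst.le).mul 𝕜)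
    ((hM.isProduct hrs.le hst.le).inner_mul 𝕜) ((hM.isProduct hrs.le hst.le).span_mul_dense 𝕜)
  assoc hrs hst htu x y z := by
    simp only [unitaryOfBilin_htmul]
    exact hM.mul_assoc 𝕜 hrs.le hst.le htu.le x y z

end IsDecomposable

end MeasureClass

end

/-! ### Multiplication by indicators on `L₂(M)` and the measures `|ψ|²` -/

noncomputable section

open MeasureTheory TopologicalSpace
open scoped ENNReal

namespace MeasureClass

variable {X : Type*} [MeasurableSpace X]

/-! For a decomposable class the random set misses all of `[0, 1]` with positive probability: every
point has a neighbourhood that is missed with positive probability, finitely many of these cover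
`[0, 1]`, and independence glues them. So in each `L₂(M_{s,t})` the vectors supported by the atom
`{∅}` form a line, the vacuum, and products of unit vacuum vectors are vacuum vectors up to a phase.

An isomorphism `U` carries the vacuum vectors of `M` to unit vectors `φ_{s,t}` of `M'` that are
again multiplicative up to a phase. Under the probability measure `|φ_{0,1}|²` the probability `q(s,
t)` of missing `[s, t]` satisfies `q(r, t) = q(r, s) q(s, t)`, and no fixed point is hit. Such a
random set is finite in `[0, 1)`, like a Poisson process: the expected number of cells of a
partition that it hits is `∑ (1 - q_i) ≤ -∑ log q_i = -log q(0, 1)`, uniformly in the mesh, and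
Fatou's lemma applies (`Effros.ae_liminf_hitCount_lt_top`). A perfect set, however, is a.s. empty or
infinite there. Hence `φ` is a vacuum family as well (`avoid_eq_self_of_multiplicative`).

Consequently `U` intertwines the projections to the vacuum, which are the multiplications by the
indicator of `C ∩ [s, t] = ∅`; by multiplicativity this holds on the whole of `H_{0,1}`
(`map_avoid`). These events generate the Effros σ-field, so `U` preserves the measures `|x|²`
(`density_map_eq`). Every measure of a class is of the form `|x|²`, and all `|x|²` are absolutely
continuous with respect to the class, so the two classes on `[0, 1]` coincide. -/

/-- All measures of one class are equivalent, so one dominating measure on each side already gives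
equivalence. -/
theorem eq_of_forall_ac {M N : MeasureClass X} (h₁ : ∀ μ ∈ M.carrier, ∃ ν ∈ N.carrier, μ ≪ ν)
    (h₂ : ∀ ν ∈ N.carrier, ∃ μ ∈ M.carrier, ν ≪ μ) : M = N := by
  have key : ∀ {M N : MeasureClass X}, (∀ μ ∈ M.carrier, ∃ ν ∈ N.carrier, μ ≪ ν) →
      (∀ ν ∈ N.carrier, ∃ μ ∈ M.carrier, ν ≪ μ) → M.carrier ⊆ N.carrier := by
    intro M N h₁ h₂ μ hμ
    obtain ⟨ν, hν, hμν⟩ := h₁ μ hμ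
    obtain ⟨μ', hμ', hνμ'⟩ := h₂ ν hν
    exact (N.mem_iff ν hν μ (M.finite μ hμ)).2
      ⟨hμν, hνμ'.trans (M.ac ⟨μ', hμ'⟩ ⟨μ, hμ⟩)⟩
  exact MeasureClass.ext (Set.Subset.antisymm (key h₁ h₂) (key h₂ h₁))

namespace L2

variable {𝕜 : Type*} [RCLike 𝕜] {M : MeasureClass X} {A B : Set X}

/-- Multiplication by the indicator of a measurable set, as an operator on `L₂(M)`. -/
def restrict (hA : MeasurableSet A) : L2 𝕜 M →ₗ[𝕜] L2 𝕜 M where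
  toFun ψ := (equivLp (ref M)).symm (((Lp.memLp (incarnation (ref M) ψ)).indicator hA).toLp _)
  map_add' ψ φ := by
    rw [← map_add, ← MemLp.toLp_add]
    refine congrArg _ ((MemLp.toLp_eq_toLp_iff _ _).2 ?_)
    rw [map_add, ← Set.indicator_add']
    filter_upwards [Lp.coeFn_add (incarnation (ref M) ψ) (incarnation (ref M) φ)] with x hx
    simp only [Set.indicator, hx]
  map_smul' c ψ := by
    rw [RingHom.id_apply, ← map_smul, ← MemLp.toLp_const_smul]
    refine congrArg _ ((MemLp.toLp_eq_toLp_iff _ _).2 ?_)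
    rw [map_smul]
    filter_upwards [Lp.coeFn_smul c (incarnation (ref M) ψ)] with x hx
    by_cases h : x ∈ A <;> simp [h, hx]

/-- Changing the incarnation multiplies by the root of a density, which commutes with an indicator;
so `restrict` does not depend on the reference measure used to define it. -/
theorem incarnation_restrict (hA : MeasurableSet A) (μ : M.carrier) (ψ : L2 𝕜 M) :
    (incarnation μ (restrict hA ψ) : X → 𝕜) =ᵐ[μ.1] A.indicator (incarnation μ ψ) := by
  have h : (incarnation (ref M) (restrict hA ψ) : X → 𝕜) =ᵐ[(ref M).1]
      A.indicator (incarnation (ref M) ψ) := by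
    have : incarnation (ref M) (restrict hA ψ) =
        ((Lp.memLp (incarnation (ref M) ψ)).indicator hA).toLp _ :=
      (equivLp (ref M)).apply_symm_apply _
    rw [this]
    exact MemLp.coeFn_toLp _
  filter_upwards [incarnation_eq (restrict hA ψ) (ref M) μ, M.ac μ (ref M) h,
    incarnation_eq ψ (ref M) μ] with x h1 h2 h3
  rw [h1, h2]
  by_cases hx : x ∈ A <;> simp [hx, h3]

theorem eq_of_incarnation_ae (μ : M.carrier) {ψ φ : L2 𝕜 M}
    (h : (incarnation μ ψ : X → 𝕜) =ᵐ[μ.1] incarnation μ φ) : ψ = φ :=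
  incarnation_injective μ (Lp.ext h)

theorem restrict_restrict (hA : MeasurableSet A) (hB : MeasurableSet B) (ψ : L2 𝕜 M) :
    restrict hA (restrict hB ψ) = restrict (hA.inter hB) ψ := by
  refine eq_of_incarnation_ae (ref M) ?_
  filter_upwards [incarnation_restrict hA (ref M) (restrict hB ψ),
    incarnation_restrict hB (ref M) ψ, incarnation_restrict (hA.inter hB) (ref M) ψ]
    with x h1 h2 h3
  rw [h1, h3]
  by_cases h : x ∈ A <;> by_cases h' : x ∈ B <;> simp [h, h', h2]

theorem restrict_congr (h : A = B) (hA : MeasurableSet A) (hB : MeasurableSet B) (ψ : L2 𝕜 M) :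
    restrict hA ψ = restrict hB ψ := by
  subst h; rfl

theorem restrict_univ (ψ : L2 𝕜 M) : restrict MeasurableSet.univ ψ = ψ := by
  refine eq_of_incarnation_ae (ref M) ?_
  filter_upwards [incarnation_restrict MeasurableSet.univ (ref M) ψ] with x h1
  rw [h1, Set.indicator_univ]

theorem inner_restrict_left (hA : MeasurableSet A) (ψ φ : L2 𝕜 M) :
    inner 𝕜 (restrict hA ψ) φ = inner 𝕜 ψ (restrict hA φ) := by
  rw [← inner_incarnation (ref M), ← inner_incarnation (ref M), MeasureTheory.L2.inner_def,
    MeasureTheory.L2.inner_def]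
  refine integral_congr_ae ?_
  filter_upwards [incarnation_restrict hA (ref M) ψ, incarnation_restrict hA (ref M) φ]
    with x h1 h2
  rw [h1, h2]
  by_cases h : x ∈ A <;> simp [h]

/-- The measure `|ψ|²`, for a vector `ψ` of `L₂(M)`. -/
def density (ψ : L2 𝕜 M) : Measure X :=
  (ref M).1.withDensity fun x => ‖incarnation (ref M) ψ x‖ₑ ^ 2

theorem enorm_incarnation (μ : M.carrier) (ψ : L2 𝕜 M) : ‖incarnation μ ψ‖ₑ = ‖ψ‖ₑ := by
  rw [← ofReal_norm, ← ofReal_norm, ← equivLp_apply, LinearIsometryEquiv.norm_map]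

theorem enorm_sq_restrict (hA : MeasurableSet A) (μ : M.carrier) (ψ : L2 𝕜 M) :
    ‖restrict hA ψ‖ₑ ^ 2 = ∫⁻ x in A, ‖incarnation μ ψ x‖ₑ ^ 2 ∂μ.1 := by
  rw [← enorm_incarnation μ, Lp.enorm_def]
  have := eLpNorm_nnreal_pow_eq_lintegral (f := incarnation μ (restrict hA ψ)) (μ := μ.1)
    (p := 2) (by norm_num)
  simp only [NNReal.coe_ofNat, ENNReal.rpow_ofNat, ENNReal.coe_ofNat] at this
  rw [this, ← lintegral_indicator hA]
  refine lintegral_congr_ae ?_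
  filter_upwards [incarnation_restrict hA μ ψ] with x h
  rw [h]
  by_cases hx : x ∈ A <;> simp [hx]

theorem density_apply (hA : MeasurableSet A) (ψ : L2 𝕜 M) :
    density ψ A = ‖restrict hA ψ‖ₑ ^ 2 := by
  rw [density, withDensity_apply _ hA, enorm_sq_restrict]

theorem density_univ (ψ : L2 𝕜 M) : density ψ Set.univ = ‖ψ‖ₑ ^ 2 := by
  rw [density_apply MeasurableSet.univ, restrict_univ]

instance (ψ : L2 𝕜 M) : IsFiniteMeasure (density ψ) :=
  ⟨by rw [density_univ]; exact ENNReal.pow_lt_top enorm_lt_top⟩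

theorem density_ac (ψ : L2 𝕜 M) (μ : M.carrier) : density ψ ≪ μ.1 :=
  (withDensity_absolutelyContinuous _ _).trans (M.ac _ _)

theorem density_real_apply (hA : MeasurableSet A) (ψ : L2 𝕜 M) :
    (density ψ).real A = ‖restrict hA ψ‖ ^ 2 := by
  rw [Measure.real, density_apply hA, ENNReal.toReal_pow, toReal_enorm]

/-- The vector `1 √μ` works. Together with `density_ac` this recovers the class from the measures
`|ψ|²`. -/
theorem exists_density_eq (μ : M.carrier) : ∃ ψ : L2 𝕜 M, density ψ = μ.1 := by
  obtain ⟨ψ, hψ⟩ := incarnation_surjective (𝕜 := 𝕜) μ ((memLp_const (1 : 𝕜)).toLp _)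
  refine ⟨ψ, Measure.ext fun A hA => ?_⟩
  rw [density_apply hA, enorm_sq_restrict hA μ, hψ, ← setLIntegral_one A]
  refine lintegral_congr_ae (ae_restrict_of_ae ?_)
  filter_upwards [(memLp_const (μ := μ.1) (p := 2) (1 : 𝕜)).coeFn_toLp] with x hx
  rw [hx]
  simp

theorem restrict_eq_self_of_density (hA : MeasurableSet A) {ψ : L2 𝕜 M}
    (h : density ψ Aᶜ = 0) : restrict hA ψ = ψ := by
  have h0 : restrict hA.compl ψ = 0 := by
    rw [density_apply hA.compl] at h
    simpa using h
  have h1 := incarnation_restrict hA.compl (ref M) ψ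
  rw [h0] at h1
  refine eq_of_incarnation_ae (ref M) ?_
  filter_upwards [incarnation_restrict hA (ref M) ψ, h1,
    Lp.coeFn_zero 𝕜 2 (ref M).1] with x h2 h3 h4
  rw [map_zero, h4] at h3
  rw [h2]
  by_cases hx : x ∈ A
  · simp [hx]
  · simpa [hx] using h3

theorem norm_restrict_le (hA : MeasurableSet A) (ψ : L2 𝕜 M) : ‖restrict hA ψ‖ ≤ ‖ψ‖ := by
  refine le_of_sq_le_sq ?_ (norm_nonneg _)
  rw [← density_real_apply hA]
  refine (measureReal_mono (Set.subset_univ A)).trans_eq ?_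
  rw [density_real_apply MeasurableSet.univ, restrict_univ]

theorem continuous_restrict (hA : MeasurableSet A) :
    Continuous (restrict hA : L2 𝕜 M → L2 𝕜 M) :=
  (LinearMap.mkContinuous (restrict hA) 1 fun ψ => by
    simpa using norm_restrict_le hA ψ).continuous

/-- On an atom, the restriction operator is the projection to any unit vector of its range. -/
theorem restrict_eq_inner_smul (hA : MeasurableSet A) (hs : A.Subsingleton) {w : L2 𝕜 M}
    (hw : restrict hA w = w) (hw1 : ‖w‖ = 1) (y : L2 𝕜 M) :
    restrict hA y = inner 𝕜 w y • w := by
  have hw0 : w ≠ 0 := fun h => by simp [h] at hw1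
  obtain ⟨c, hc⟩ : ∃ c : 𝕜, restrict hA y = c • w := by
    have h1 := incarnation_restrict hA (ref M) w
    rw [hw] at h1
    have h2 := incarnation_restrict hA (ref M) y
    -- `A` has at most one point. If the representative of `w` is nonzero there, the ratio of the
    -- two values is the scalar; otherwise `w = 0`, against `‖w‖ = 1`.
    by_cases h : ∃ a ∈ A, incarnation (ref M) w a ≠ 0
    · obtain ⟨a, ha, hne⟩ := h
      refine ⟨incarnation (ref M) y a / incarnation (ref M) w a, eq_of_incarnation_ae (ref M) ?_⟩
      rw [map_smul]
      filter_upwards [h1, h2, Lp.coeFn_smul (incarnation (ref M) y a / incarnation (ref M) w a)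
        (incarnation (ref M) w)] with x h1 h2 h3
      rw [h2, h3, Pi.smul_apply]
      by_cases hx : x ∈ A
      · rw [Set.indicator_of_mem hx, hs hx ha, smul_eq_mul, div_mul_cancel₀ _ hne]
      · rw [Set.indicator_of_notMem hx] at h1 ⊢
        rw [h1, smul_zero]
    · push Not at h
      refine absurd (eq_of_incarnation_ae (ref M) ?_) hw0
      rw [map_zero]
      filter_upwards [h1, Lp.coeFn_zero 𝕜 2 (ref M).1] with x h1 h2
      rw [h1, h2]
      by_cases hx : x ∈ A
      · rw [Set.indicator_of_mem hx, h x hx, Pi.zero_apply]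
      · rw [Set.indicator_of_notMem hx, Pi.zero_apply]
  have : inner 𝕜 w y = c := by
    conv_lhs => rw [← hw]
    rw [inner_restrict_left, hc, inner_smul_right, inner_self_eq_norm_sq_to_K, hw1]
    simp
  rw [this, hc]

/-- An atom of positive measure carries a unit vector. -/
theorem exists_unit_restrict_eq (hA : MeasurableSet A) (μ : M.carrier) (hμ : μ.1 A ≠ 0) :
    ∃ w : L2 𝕜 M, restrict hA w = w ∧ ‖w‖ = 1 := by
  obtain ⟨ψ, hψ⟩ := exists_density_eq (𝕜 := 𝕜) μ
  have h0 : restrict hA ψ ≠ 0 := by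
    intro h
    rw [← hψ, density_apply hA, h] at hμ
    simp at hμ
  refine ⟨((‖restrict hA ψ‖⁻¹ : ℝ) : 𝕜) • restrict hA ψ, ?_, ?_⟩
  · rw [map_smul, restrict_restrict, restrict_congr (Set.inter_self A) _ hA]
  · rw [norm_smul, RCLike.norm_ofReal, abs_of_nonneg (by positivity),
      inv_mul_cancel₀ (norm_ne_zero_iff.2 h0)]

end L2

end MeasureClass

/-! ### Norms and indicators of products of vectors -/

namespace IsProduct

open MeasureClass MeasureClass.L2

variable {X X₁ X₂ : Type*} [MeasurableSpace X] [MeasurableSpace X₁] [MeasurableSpace X₂]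
  {M₁ : MeasureClass X₁} {M₂ : MeasureClass X₂} {M : MeasureClass X}
  {p : X → X₁} {q : X → X₂} {j : X₁ × X₂ → X} (h : IsProduct M₁ M₂ M p q j)
  {𝕜 : Type*} [RCLike 𝕜]


theorem norm_mul (ψ : L2 𝕜 M₁) (φ : L2 𝕜 M₂) : ‖h.mul 𝕜 ψ φ‖ = ‖ψ‖ * ‖φ‖ := by
  have := h.inner_mul 𝕜 ψ ψ φ φ
  rw [inner_self_eq_norm_sq_to_K, inner_self_eq_norm_sq_to_K, inner_self_eq_norm_sq_to_K] at this
  have h2 : ‖h.mul 𝕜 ψ φ‖ ^ 2 = (‖ψ‖ * ‖φ‖) ^ 2 := by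
    rw [mul_pow]
    exact_mod_cast this
  exact (pow_left_inj₀ (norm_nonneg _) (by positivity) two_ne_zero).1 h2

/-- The indicator of a rectangle is a product of indicators. The equation for `D` is a hypothesis
because the events used below are rectangles only after rewriting. -/
theorem restrict_mul {A : Set X₁} {B : Set X₂} {D : Set X} (hA : MeasurableSet A)
    (hB : MeasurableSet B) (hD : MeasurableSet D) (hABD : D = p ⁻¹' A ∩ q ⁻¹' B)
    (ψ : L2 𝕜 M₁) (φ : L2 𝕜 M₂) :
    restrict hD (h.mul 𝕜 ψ φ) = h.mul 𝕜 (restrict hA ψ) (restrict hB φ) := by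
  refine eq_of_incarnation_ae (h.prodMeasure (ref M₁) (ref M₂)) ?_
  filter_upwards [incarnation_restrict hD (h.prodMeasure (ref M₁) (ref M₂)) (h.mul 𝕜 ψ φ),
    h.incarnation_mul 𝕜 (ref M₁) (ref M₂) ψ φ,
    h.incarnation_mul 𝕜 (ref M₁) (ref M₂) (restrict hA ψ) (restrict hB φ),
    h.ae_p (ref M₁) (ref M₂) (incarnation_restrict hA (ref M₁) ψ),
    h.ae_q (ref M₁) (ref M₂) (incarnation_restrict hB (ref M₂) φ)] with x h1 h2 h3 h4 h5
  rw [h1, h3, h4, h5, hABD]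
  by_cases hx : p x ∈ A <;> by_cases hy : q x ∈ B <;> simp [hx, hy, h2, Set.indicator]

/-- A continuous linear identity on `L₂(M)` can be checked on products of vectors. -/
theorem ext_mul {F : Type*} [AddCommGroup F] [Module 𝕜 F] [TopologicalSpace F] [T2Space F]
    {S T : L2 𝕜 M →ₗ[𝕜] F} (hS : Continuous S) (hT : Continuous T)
    (hST : ∀ ψ φ, S (h.mul 𝕜 ψ φ) = T (h.mul 𝕜 ψ φ)) (x : L2 𝕜 M) : S x = T x := by
  have hd := Submodule.dense_iff_topologicalClosure_eq_top.2 (h.span_mul_dense 𝕜)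
  refine congrFun (hS.ext_on hd hT fun y hy => ?_) x
  refine LinearMap.eqOn_span (s := Set.range fun z : L2 𝕜 M₁ × L2 𝕜 M₂ => h.mul 𝕜 z.1 z.2) ?_ hy
  rintro _ ⟨z, rfl⟩
  exact hST _ _

end IsProduct

end

/-! ### Avoidance events and random sets with a multiplicative avoidance function -/

noncomputable section

open MeasureTheory TopologicalSpace Filter
open scoped ENNReal

namespace Effros

/-- The event that a closed set does not hit the interval `[s, t]`. -/
def missSet (s t : ℝ) : Set (Closeds ℝ) := {C | Disjoint (C : Set ℝ) (Set.Icc s t)}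

theorem measurableSet_missSet (s t : ℝ) : MeasurableSet (missSet s t) := by
  have : missSet s t = {C : Closeds ℝ | ((C : Set ℝ) ∩ Set.Icc s t).Nonempty}ᶜ := by
    ext C
    simp [missSet, Set.disjoint_iff_inter_eq_empty, Set.not_nonempty_iff_eq_empty]
  rw [this]
  exact (measurableSet_hit_compact isCompact_Icc).compl

theorem missSet_anti {s s' t t' : ℝ} (hs : s ≤ s') (ht : t' ≤ t) :
    missSet s t ⊆ missSet s' t' :=
  fun _ hC => Set.disjoint_of_subset_right (Set.Icc_subset_Icc hs ht) hC

theorem missSet_inter {r s t : ℝ} (hrs : r ≤ s) (hst : s ≤ t) :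
    missSet r s ∩ missSet s t = missSet r t := by
  ext C
  simp only [missSet, Set.mem_inter_iff, Set.mem_ofPred_eq]
  rw [← Set.disjoint_union_right, Set.Icc_union_Icc_eq_Icc hrs hst]

theorem missSet_self (t : ℝ) : missSet t t = {C : Closeds ℝ | t ∈ C}ᶜ := by
  ext C
  simp [missSet]

/-- A closed set avoiding a point avoids some closed interval around it. -/
theorem exists_mem_missSet {C : Closeds ℝ} {x : ℝ} (hx : x ∉ C) :
    ∃ n : ℕ, C ∈ missSet (x - 1 / (n + 1)) (x + 1 / (n + 1)) := by
  obtain ⟨ε, hε, hsub⟩ := Metric.isOpen_iff.1 C.isClosed.isOpen_compl x hx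
  obtain ⟨n, hn⟩ := exists_nat_one_div_lt hε
  refine ⟨n, Set.disjoint_left.2 fun y hy hy' => hsub ?_ hy⟩
  rw [Metric.mem_ball, Real.dist_eq, abs_lt]
  constructor <;> linarith [hy'.1, hy'.2]

/-- The events of missing the shrinking intervals exhaust the event of missing `x`, which has full
measure, so they cannot all be null. -/
theorem exists_measure_missSet_ne_zero {ν : Measure (Closeds ℝ)} (hν : ν ≠ 0) {x : ℝ}
    (hx : ν {C | x ∈ C} = 0) :
    ∃ n : ℕ, ν (missSet (x - 1 / (n + 1)) (x + 1 / (n + 1))) ≠ 0 := by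
  by_contra! h
  have h1 : ν {C | x ∈ C}ᶜ = 0 := measure_mono_null
    (fun C hC => Set.mem_iUnion.2 (exists_mem_missSet hC)) (measure_iUnion_null h)
  refine hν (Measure.measure_univ_eq_zero.1 ?_)
  rw [← Set.union_compl_self {C : Closeds ℝ | x ∈ C}]
  exact measure_union_null hx h1

/-- If the events of avoiding adjacent intervals are jointly possible as soon as each of them is,
then avoiding the whole unit interval is possible. -/
theorem measure_missSet_ne_zero {ν : Measure (Closeds ℝ)} (hν : ν ≠ 0)
    (h0 : ∀ x : ℝ, ν {C | x ∈ C} = 0)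
    (hmul : ∀ r s t : ℝ, 0 ≤ r → r ≤ s → s ≤ t → t ≤ 1 → ν (missSet r s) ≠ 0 →
      ν (missSet s t) ≠ 0 → ν (missSet r t) ≠ 0) :
    ν (missSet 0 1) ≠ 0 := by
  choose n hn using fun x : ℝ => exists_measure_missSet_ne_zero hν (h0 x)
  have hcov : (Set.univ : Set unitInterval) ⊆ ⋃ x : ℝ,
      {y : unitInterval | (y : ℝ) ∈ Metric.ball x (1 / (n x + 1))} := fun y _ =>
    Set.mem_iUnion.2 ⟨y, Metric.mem_ball_self (by positivity)⟩
  -- By compactness there is a monotone sequence from `0`, eventually equal to `1`, each of whose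
  -- cells lies in one of the chosen neighbourhoods. Gluing the cells one at a time by `hmul`
  -- reaches `[0, 1]`.
  obtain ⟨t, ht0, hmono, ⟨m, hm⟩, hsub⟩ := exists_monotone_Icc_subset_open_cover_unitInterval
    (c := fun x : ℝ => {y : unitInterval | (y : ℝ) ∈ Metric.ball x (1 / (n x + 1))})
    (fun x => Metric.isOpen_ball.preimage continuous_subtype_val) hcov
  have key : ∀ k : ℕ, ν (missSet 0 (t k)) ≠ 0 := by
    intro k
    induction k with
    | zero =>
      rw [ht0, Set.Icc.coe_zero, missSet_self]
      intro h
      refine hν (Measure.measure_univ_eq_zero.1 ?_)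
      rw [← Set.union_compl_self {C : Closeds ℝ | (0 : ℝ) ∈ C}]
      exact measure_union_null (h0 0) h
    | succ k ih =>
      refine hmul _ _ _ le_rfl (t k).2.1 (hmono k.le_succ) (t (k + 1)).2.2 ih fun h => ?_
      obtain ⟨x, hx⟩ := hsub k
      have h1 := hx (Set.left_mem_Icc.2 (hmono k.le_succ))
      have h2 := hx (Set.right_mem_Icc.2 (hmono k.le_succ))
      simp only [Set.mem_ofPred_eq, Metric.mem_ball, Real.dist_eq, abs_lt] at h1 h2
      exact hn x (measure_mono_null (missSet_anti (by linarith) (by linarith)) h)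
  have := key m
  rwa [hm m le_rfl] at this

/-- The number of the intervals `[i / (n + 1), (i + 1) / (n + 1)]`, `0 ≤ i ≤ n`, hit by a set. -/
def hitCount (n : ℕ) (C : Closeds ℝ) : ℝ≥0∞ :=
  ∑ i ∈ Finset.range (n + 1),
    (missSet (i / (n + 1)) ((i + 1 : ℕ) / (n + 1)))ᶜ.indicator (fun _ => 1) C

theorem measurable_hitCount (n : ℕ) : Measurable (hitCount n) :=
  Finset.measurable_sum _ fun _ _ =>
    measurable_const.indicator (measurableSet_missSet _ _).compl

theorem lintegral_hitCount (ν : Measure (Closeds ℝ)) (n : ℕ) :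
    ∫⁻ C, hitCount n C ∂ν =
      ∑ i ∈ Finset.range (n + 1), ν (missSet (i / (n + 1)) ((i + 1 : ℕ) / (n + 1)))ᶜ := by
  simp only [hitCount]
  rw [lintegral_finsetSum]
  · refine Finset.sum_congr rfl fun i _ => ?_
    rw [lintegral_indicator (measurableSet_missSet _ _).compl, setLIntegral_one]
  · exact fun i _ => measurable_const.indicator (measurableSet_missSet _ _).compl

/-- Once the mesh `1 / (n + 1)` is smaller than all distances between points of `F`, these points
lie in distinct cells. Excluding `1` keeps the cell index at most `n`. -/
theorem card_le_hitCount {C : Closeds ℝ} {F : Finset ℝ}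
    (hF : (F : Set ℝ) ⊆ (C : Set ℝ) ∩ Set.Ico 0 1) :
    ∀ᶠ n : ℕ in atTop, (F.card : ℝ≥0∞) ≤ hitCount n C := by
  obtain ⟨δ, hδ, hsep⟩ : ∃ δ > 0, ∀ x ∈ F, ∀ y ∈ F, x ≠ y → δ ≤ |x - y| := by
    have h1 : ∀ z ∈ F.offDiag.image fun z => |z.1 - z.2|, 0 < z := by
      intro z hz
      obtain ⟨w, hw, rfl⟩ := Finset.mem_image.1 hz
      exact abs_pos.2 (sub_ne_zero.2 (Finset.mem_offDiag.1 hw).2.2)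
    rcases (F.offDiag.image fun z => |z.1 - z.2|).eq_empty_or_nonempty with h | h
    · refine ⟨1, one_pos, fun x hx y hy hxy => ?_⟩
      have := Finset.mem_image_of_mem (fun z : ℝ × ℝ => |z.1 - z.2|)
        (Finset.mem_offDiag.2 ⟨hx, hy, hxy⟩ : (x, y) ∈ F.offDiag)
      rw [h] at this
      exact absurd this (Finset.notMem_empty _)
    · exact ⟨_, h1 _ (Finset.min'_mem _ h), fun x hx y hy hxy => Finset.min'_le _ _
        (Finset.mem_image_of_mem (fun z : ℝ × ℝ => |z.1 - z.2|)
        (Finset.mem_offDiag.2 ⟨hx, hy, hxy⟩ : (x, y) ∈ F.offDiag))⟩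
  obtain ⟨N, hN⟩ := exists_nat_one_div_lt hδ
  filter_upwards [eventually_ge_atTop N] with n hn
  have hnpos : (0 : ℝ) < n + 1 := by positivity
  have hnδ : 1 / ((n : ℝ) + 1) < δ := by
    refine lt_of_le_of_lt ?_ hN
    exact one_div_le_one_div_of_le (by positivity) (by exact_mod_cast Nat.succ_le_succ hn)
  -- `g x` is the index of the cell containing `x`.
  set g : ℝ → ℕ := fun x => ⌊x * (n + 1)⌋₊ with hg
  have hfl : ∀ x ∈ F, (g x : ℝ) ≤ x * (n + 1) ∧ x * (n + 1) < g x + 1 := fun x hx =>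
    ⟨Nat.floor_le (mul_nonneg (hF hx).2.1 hnpos.le), Nat.lt_floor_add_one _⟩
  have hinj : Set.InjOn g F := by
    intro x hx y hy hxy
    by_contra hne
    have h1 := hfl x hx
    have h2 := hfl y hy
    rw [hxy] at h1
    have h3 : |x - y| * (n + 1) < 1 := by
      rw [← abs_of_pos hnpos, ← abs_mul, abs_lt]
      constructor <;> nlinarith
    have h4 := hsep x hx y hy hne
    rw [div_lt_iff₀ hnpos] at hnδ
    nlinarith
  rw [← Finset.card_image_of_injOn hinj, Finset.cast_card]
  have hsub : F.image g ⊆ Finset.range (n + 1) := by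
    intro i hi
    obtain ⟨x, hx, rfl⟩ := Finset.mem_image.1 hi
    rw [Finset.mem_range]
    have h1 := (hfl x hx).1
    have h2 : x * (n + 1) < n + 1 := by nlinarith [(hF hx).2.2]
    exact_mod_cast h1.trans_lt h2
  refine (Finset.sum_le_sum fun i hi => ?_).trans (Finset.sum_le_sum_of_subset hsub)
  obtain ⟨x, hx, rfl⟩ := Finset.mem_image.1 hi
  rw [Set.indicator_of_mem]
  refine Set.not_disjoint_iff.2 ⟨x, (hF hx).1, ?_, ?_⟩
  · rw [div_le_iff₀ hnpos]
    exact (hfl x hx).1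
  · rw [le_div_iff₀ hnpos]
    push_cast
    exact (hfl x hx).2.le

theorem liminf_hitCount_eq_top {C : Closeds ℝ} (hC : ((C : Set ℝ) ∩ Set.Ico 0 1).Infinite) :
    liminf (fun n => hitCount n C) atTop = ⊤ := by
  refine ENNReal.eq_top_of_forall_nnreal_le fun r => ?_
  obtain ⟨k, hk⟩ := exists_nat_ge r
  obtain ⟨F, hF, hcard⟩ := hC.exists_subset_card_eq k
  refine le_trans ?_ (le_liminf_of_le (by isBoundedDefault) (card_le_hitCount hF))
  rw [hcard]
  exact_mod_cast hk

/-- A random closed set whose avoidance function is multiplicative hits the unit interval at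
finitely many points only. -/
theorem ae_liminf_hitCount_lt_top {ν : Measure (Closeds ℝ)} [IsProbabilityMeasure ν]
    (h0 : ∀ x : ℝ, ν {C | x ∈ C} = 0)
    (hmul : ∀ r s t : ℝ, 0 ≤ r → r ≤ s → s ≤ t → t ≤ 1 →
      ν.real (missSet r t) = ν.real (missSet r s) * ν.real (missSet s t)) :
    ∀ᵐ C ∂ν, liminf (fun n => hitCount n C) atTop < ⊤ := by
  have hne : ν (missSet 0 1) ≠ 0 := by
    refine measure_missSet_ne_zero (IsProbabilityMeasure.ne_zero ν) h0
      fun r s t hr hrs hst ht h1 h2 => ?_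
    rw [← measureReal_ne_zero_iff] at h1 h2 ⊢
    rw [hmul r s t hr hrs hst ht]
    exact mul_ne_zero h1 h2
  have hpos : ∀ s t : ℝ, 0 ≤ s → t ≤ 1 → 0 < ν.real (missSet s t) := fun s t hs ht =>
    (measureReal_nonneg.lt_of_ne' ((measureReal_ne_zero_iff).2 hne)).trans_le
      (measureReal_mono (missSet_anti hs ht))
  -- Multiplicativity makes `-log q` additive over the cells, and `1 - q ≤ -log q` on each of them.
  -- The resulting bound does not depend on `n`.
  have hbound : ∀ n : ℕ, ∫⁻ C, hitCount n C ∂ν ≤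
      ENNReal.ofReal (-Real.log (ν.real (missSet 0 1))) := by
    intro n
    have hn : (0 : ℝ) < n + 1 := by positivity
    have hle : ∀ k : ℕ, k ≤ n + 1 → (k : ℝ) / (n + 1) ≤ 1 := fun k hk => by
      rw [div_le_one hn]; exact_mod_cast hk
    have hlog : ∀ k : ℕ, k ≤ n + 1 → ∑ i ∈ Finset.range k,
        -Real.log (ν.real (missSet (i / (n + 1)) ((i + 1 : ℕ) / (n + 1)))) =
          -Real.log (ν.real (missSet 0 (k / (n + 1)))) := by
      intro k hk
      induction k with
      | zero =>
        -- The empty sum matches `-log 1`: the degenerate interval at `0` is missed almost surely.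
        rw [Finset.sum_range_zero, Nat.cast_zero, zero_div, missSet_self,
          probReal_compl_eq_one_sub (Effros.measurableSet_mem 0), measureReal_def, h0]
        simp
      | succ k ih =>
        rw [Finset.sum_range_succ, ih (by omega),
          hmul 0 (k / (n + 1)) ((k + 1 : ℕ) / (n + 1)) le_rfl (by positivity)
            (by gcongr; simp) (hle _ hk),
          Real.log_mul (hpos _ _ le_rfl (hle _ (by omega))).ne'
            (hpos _ _ (by positivity) (hle _ hk)).ne']
        ring
    rw [lintegral_hitCount]
    have h1 := hlog (n + 1) le_rfl
    have h2 : ((n + 1 : ℕ) : ℝ) / (n + 1) = 1 := by push_cast; exact div_self hn.ne'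
    rw [h2] at h1
    rw [← h1, ENNReal.ofReal_sum_of_nonneg fun i _ =>
      neg_nonneg.2 (Real.log_nonpos measureReal_nonneg measureReal_le_one)]
    refine Finset.sum_le_sum fun i hi => ?_
    rw [← ofReal_measureReal, probReal_compl_eq_one_sub (measurableSet_missSet _ _)]
    refine ENNReal.ofReal_le_ofReal ?_
    have := Real.log_le_sub_one_of_pos (hpos (i / (n + 1)) ((i + 1 : ℕ) / (n + 1))
      (by positivity) (hle _ (Finset.mem_range.1 hi)))
    linarith
  -- By Fatou's lemma the lower limit of the hit counts has finite expectation.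
  refine ae_lt_top (Measurable.liminf fun n => measurable_hitCount n) (ne_of_lt ?_)
  refine (lintegral_liminf_le fun n => measurable_hitCount n).trans_lt ?_
  refine lt_of_le_of_lt ?_ (ENNReal.ofReal_lt_top (r := -Real.log (ν.real (missSet 0 1))))
  exact liminf_le_of_frequently_le' (Frequently.of_forall hbound)

/-- A perfect set hitting an open interval has infinitely many points in it. -/
theorem infinite_inter_of_perfect {C : Set ℝ} (hC : Perfect C) {U : Set ℝ} (hU : IsOpen U)
    (h : (C ∩ U).Nonempty) : (C ∩ U).Infinite := by
  obtain ⟨x, hx⟩ := h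
  rw [Set.inter_comm]
  exact .of_accPt (hC.acc.open_inter hU x ⟨hx.2, hx.1⟩)

end Effros

end

/-! ### Avoidance events for closed subsets of a segment -/

noncomputable section

open MeasureTheory TopologicalSpace Filter
open scoped ENNReal unitInterval

/-- The event that a closed subset of `[a, b]` does not hit the interval `[s, t]`. -/
def missIn (a b s t : ℝ) : Set (ClosedIn a b) := Subtype.val ⁻¹' Effros.missSet s t

theorem measurableSet_missIn (a b s t : ℝ) : MeasurableSet (missIn a b s t) :=
  measurable_subtype_coe (Effros.measurableSet_missSet s t)

/-- Only `∅` misses the whole segment; this is what makes the vacuum one-dimensional. -/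
theorem missIn_subsingleton (a b : ℝ) : (missIn a b a b).Subsingleton := by
  have key : ∀ C ∈ missIn a b a b, (C.1 : Set ℝ) = ∅ := fun C hC => by
    rw [← Set.inter_eq_left.2 C.2]
    exact Set.disjoint_iff_inter_eq_empty.1 hC
  intro C hC D hD
  exact Subtype.ext (SetLike.coe_injective ((key C hC).trans (key D hD).symm))

theorem cut_preimage_missIn {r s u v : ℝ} (hu : r ≤ u) (hv : v ≤ s) :
    cut r s ⁻¹' missIn r s u v = Effros.missSet u v := by
  ext C
  change Disjoint ((C : Set ℝ) ∩ Set.Icc r s) (Set.Icc u v) ↔ Disjoint (C : Set ℝ) (Set.Icc u v)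
  rw [Set.disjoint_iff_inter_eq_empty, Set.disjoint_iff_inter_eq_empty, Set.inter_assoc,
    Set.inter_eq_right.2 (Set.Icc_subset_Icc hu hv)]

theorem cut_val_preimage_missIn {a b r s u v : ℝ} (hu : r ≤ u) (hv : v ≤ s) :
    (fun C : ClosedIn a b => cut r s C.1) ⁻¹' missIn r s u v = missIn a b u v :=
  congrArg (Subtype.val ⁻¹' ·) (cut_preimage_missIn hu hv)

theorem Effros.measurableSet_effrosOn_missSet {F : Closeds ℝ} {s t : ℝ}
    (h : Set.Icc s t ⊆ (F : Set ℝ)) : MeasurableSet[effrosOn F] (Effros.missSet s t) := by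
  refine ⟨_, Effros.measurableSet_missSet s t, ?_⟩
  ext C
  change Disjoint ((C : Set ℝ) ∩ (F : Set ℝ)) (Set.Icc s t) ↔ Disjoint (C : Set ℝ) (Set.Icc s t)
  rw [Set.disjoint_iff_inter_eq_empty, Set.disjoint_iff_inter_eq_empty, Set.inter_assoc,
    Set.inter_eq_right.2 h]

/-- The σ-field on the closed subsets of `[0, 1]` is generated by the events of avoiding the
nondegenerate subintervals of `[0, 1]`. -/
theorem measurableSpace_closedIn_le (m : MeasurableSpace (ClosedIn (0 : I) (1 : I)))
    (h : ∀ s t : I, s < t → MeasurableSet[m] (missIn (0 : I) (1 : I) s t)) :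
    Subtype.instMeasurableSpace ≤ m := by
  refine MeasurableSpace.comap_le_iff_le_map.2 ?_
  refine Effros.effros_le (MeasurableSpace.map Subtype.val m) fun q r => ?_
  -- The open ball is exhausted by closed intervals with rational ends. These are clamped to `[0,
  -- 1]`, which loses no point of `C`, and only those that stay nondegenerate are kept.
  have key : (Subtype.val ⁻¹' {C : Closeds ℝ |
      ((C : Set ℝ) ∩ Metric.ball (q : ℝ) (r : ℝ)).Nonempty} : Set (ClosedIn (0 : I) (1 : I))) =
      ⋃ (a : ℚ) (b : ℚ) (_ : (q : ℝ) - r < a) (_ : (b : ℝ) < q + r)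
        (_ : Set.projIcc (0 : ℝ) 1 zero_le_one a < Set.projIcc (0 : ℝ) 1 zero_le_one b),
        (missIn (0 : I) (1 : I) (Set.projIcc (0 : ℝ) 1 zero_le_one a)
          (Set.projIcc (0 : ℝ) 1 zero_le_one b))ᶜ := by
    ext C
    simp only [Set.mem_preimage, Set.mem_ofPred_eq, Set.mem_iUnion, Set.mem_compl_iff,
      exists_prop]
    constructor
    · rintro ⟨x, hxC, hx⟩
      have hx01 : 0 ≤ x ∧ x ≤ 1 := C.2 hxC
      rw [Metric.mem_ball, Real.dist_eq, abs_lt] at hx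
      obtain ⟨a, ha1, ha2⟩ := exists_rat_btwn (show (q : ℝ) - r < x by linarith)
      obtain ⟨b, hb1, hb2⟩ := exists_rat_btwn (show x < (q : ℝ) + r by linarith)
      refine ⟨a, b, ha1, hb2, ?_, Set.not_disjoint_iff.2 ⟨x, hxC, ?_, ?_⟩⟩
      · rw [← Subtype.coe_lt_coe, Set.coe_projIcc, Set.coe_projIcc]
        refine max_lt (lt_max_of_lt_right (lt_min one_pos (by linarith)))
          ((min_le_right _ _).trans_lt (lt_max_of_lt_right (lt_min (by linarith) (by linarith))))
      · rw [Set.coe_projIcc]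
        exact max_le hx01.1 ((min_le_right _ _).trans ha2.le)
      · rw [Set.coe_projIcc]
        exact le_max_of_le_right (le_min hx01.2 hb1.le)
    · rintro ⟨a, b, ha, hb, hab, hC⟩
      obtain ⟨x, hxC, hx1, hx2⟩ := Set.not_disjoint_iff.1 hC
      rw [← Subtype.coe_lt_coe] at hab
      rw [Set.coe_projIcc] at hx1 hx2 hab
      rw [Set.coe_projIcc] at hab
      -- Nondegeneracy after clamping forces `a < 1` and `0 < b`, so the clamped interval lies in
      -- `[a, b]`.
      have ha1 : (a : ℝ) < 1 := by
        by_contra! h1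
        rw [min_eq_left h1] at hab
        exact absurd hab (not_lt.2 ((max_le zero_le_one (min_le_left _ _)).trans
          (le_max_right _ _)))
      have hb0 : (0 : ℝ) < b := by
        by_contra! h1
        rw [min_eq_right (h1.trans zero_le_one), max_eq_left h1] at hab
        exact absurd hab (not_lt.2 (le_max_left _ _))
      refine ⟨x, hxC, ?_⟩
      rw [Metric.mem_ball, Real.dist_eq, abs_lt]
      have h1 : (a : ℝ) ≤ x := by
        rw [min_eq_right ha1.le] at hx1
        exact (le_max_right _ _).trans hx1
      have h2 : x ≤ b := hx2.trans (max_le hb0.le (min_le_right _ _))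
      constructor <;> linarith
  change MeasurableSet[m] (Subtype.val ⁻¹' _)
  rw [key]
  exact MeasurableSet.iUnion fun a => MeasurableSet.iUnion fun b => MeasurableSet.iUnion fun _ =>
    MeasurableSet.iUnion fun _ => MeasurableSet.iUnion fun hab => (h _ _ hab).compl

/-! ### Avoidance operators, vacuum vectors and multiplicative families -/

namespace MeasureClass

open L2

/-- Multiplication by the indicator of the event of avoiding `[s, t]`. -/
abbrev avoid {𝕜 : Type*} [RCLike 𝕜] {a b : ℝ} {N : MeasureClass (ClosedIn a b)} (s t : ℝ) :
    L2 𝕜 N →ₗ[𝕜] L2 𝕜 N :=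
  restrict (measurableSet_missIn a b s t)

namespace IsDecomposable

variable {𝕜 : Type*} [RCLike 𝕜] {M : MeasureClass (Closeds ℝ)} (hM : M.IsDecomposable)
  {r s t u v : ℝ}

/-- Missing `[u, v] ⊆ [r, s]` is a condition on `C ∩ [r, s]` alone, so the operator acts on the left
factor only. -/
theorem avoid_mul_left (hrs : r ≤ s) (hst : s ≤ t) (hu : r ≤ u) (hv : v ≤ s)
    (x : L2 𝕜 (M.cutClass r s)) (y : L2 𝕜 (M.cutClass s t)) :
    avoid u v ((hM.isProduct hrs hst).mul 𝕜 x y) =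
      (hM.isProduct hrs hst).mul 𝕜 (avoid u v x) y := by
  rw [(hM.isProduct hrs hst).restrict_mul (measurableSet_missIn r s u v) MeasurableSet.univ,
    restrict_univ]
  rw [Set.preimage_univ, Set.inter_univ, cut_val_preimage_missIn hu hv]

theorem avoid_mul_right (hrs : r ≤ s) (hst : s ≤ t) (hu : s ≤ u) (hv : v ≤ t)
    (x : L2 𝕜 (M.cutClass r s)) (y : L2 𝕜 (M.cutClass s t)) :
    avoid u v ((hM.isProduct hrs hst).mul 𝕜 x y) =
      (hM.isProduct hrs hst).mul 𝕜 x (avoid u v y) := by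
  rw [(hM.isProduct hrs hst).restrict_mul MeasurableSet.univ (measurableSet_missIn s t u v),
    restrict_univ]
  rw [Set.preimage_univ, Set.univ_inter, cut_val_preimage_missIn hu hv]

theorem avoid_mul (hrs : r ≤ s) (hst : s ≤ t)
    (x : L2 𝕜 (M.cutClass r s)) (y : L2 𝕜 (M.cutClass s t)) :
    avoid r t ((hM.isProduct hrs hst).mul 𝕜 x y) =
      (hM.isProduct hrs hst).mul 𝕜 (avoid r s x) (avoid s t y) := by
  refine (hM.isProduct hrs hst).restrict_mul _ _ _ ?_ x y
  rw [cut_val_preimage_missIn le_rfl le_rfl, cut_val_preimage_missIn le_rfl le_rfl, missIn,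
    missIn, missIn, ← Set.preimage_inter, Effros.missSet_inter hrs hst]

-- The measure that provides independence depends on the cutting point `s`. Null events are common
-- to the whole class, so the conclusion that a joint event is not null passes to the fixed measure
-- `μ`.
include hM in
theorem measure_missSet_ne_zero {μ : Measure (Closeds ℝ)} (hμ : μ ∈ M.carrier) :
    μ (Effros.missSet 0 1) ≠ 0 := by
  have hac : ∀ {κ : Measure (Closeds ℝ)}, κ ∈ M.carrier → μ ≪ κ ∧ κ ≪ μ := fun hκ =>
    ⟨M.ac ⟨μ, hμ⟩ ⟨_, hκ⟩, M.ac ⟨_, hκ⟩ ⟨μ, hμ⟩⟩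
  refine Effros.measure_missSet_ne_zero ?_ (fun x => hM.negligible x μ hμ)
    fun r s t _ hrs hst _ h1 h2 h3 => ?_
  · rintro rfl
    obtain ⟨κ, hκ, hprob, -⟩ := hM.independent 0
    exact IsProbabilityMeasure.ne_zero κ (Measure.absolutelyContinuous_zero_iff.1 (hac hκ).2)
  · obtain ⟨κ, hκ, hprob, hind⟩ := hM.independent s
    have := (ProbabilityTheory.Indep_iff _ _ _).1 hind (Effros.missSet r s) (Effros.missSet s t)
      (Effros.measurableSet_effrosOn_missSet Set.Icc_subset_Iic_self)
      (Effros.measurableSet_effrosOn_missSet Set.Icc_subset_Ici_self)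
    rw [Effros.missSet_inter hrs hst, (hac hκ).2 h3, eq_comm, mul_eq_zero] at this
    exact this.elim (fun h => h1 ((hac hκ).1 h)) fun h => h2 ((hac hκ).1 h)

include hM in
/-- The vector of `L₂(M_{s,t})` supported by the empty set. -/
theorem exists_vacuum (𝕜 : Type*) [RCLike 𝕜] {s t : ℝ} (hs : 0 ≤ s) (ht : t ≤ 1) :
    ∃ w : L2 𝕜 (M.cutClass s t), avoid s t w = w ∧ ‖w‖ = 1 := by
  obtain ⟨μ, hμ⟩ := M.nonempty
  refine exists_unit_restrict_eq _ ⟨μ.map (cut s t), ⟨μ, hμ, rfl⟩⟩ fun h => ?_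
  rw [Measure.map_apply (measurable_cut s t) (measurableSet_missIn _ _ _ _),
    cut_preimage_missIn le_rfl le_rfl] at h
  exact hM.measure_missSet_ne_zero hμ (measure_mono_null (Effros.missSet_anti hs ht) h)

/-- The operator acts on `x` alone and the factors `y` and `c` have norm one. Thus the probability
of missing `[u, v]` is the same under `|z|²` as under `|x|²`. -/
theorem norm_avoid_left (hrs : r ≤ s) (hst : s ≤ t) (hu : r ≤ u) (hv : v ≤ s)
    {x : L2 𝕜 (M.cutClass r s)} {y : L2 𝕜 (M.cutClass s t)} {z : L2 𝕜 (M.cutClass r t)} {c : 𝕜}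
    (hy : ‖y‖ = 1) (hc : ‖c‖ = 1) (h : (hM.isProduct hrs hst).mul 𝕜 x y = c • z) :
    ‖avoid u v z‖ = ‖avoid u v x‖ := by
  have := congrArg norm (congrArg (avoid u v) h)
  rwa [hM.avoid_mul_left hrs hst hu hv, map_smul, norm_smul, hc, one_mul,
    IsProduct.norm_mul, hy, mul_one, eq_comm] at this

theorem norm_avoid_right (hrs : r ≤ s) (hst : s ≤ t) (hu : s ≤ u) (hv : v ≤ t)
    {x : L2 𝕜 (M.cutClass r s)} {y : L2 𝕜 (M.cutClass s t)} {z : L2 𝕜 (M.cutClass r t)} {c : 𝕜}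
    (hx : ‖x‖ = 1) (hc : ‖c‖ = 1) (h : (hM.isProduct hrs hst).mul 𝕜 x y = c • z) :
    ‖avoid u v z‖ = ‖avoid u v y‖ := by
  have := congrArg norm (congrArg (avoid u v) h)
  rwa [hM.avoid_mul_right hrs hst hu hv, map_smul, norm_smul, hc, one_mul,
    IsProduct.norm_mul, hx, one_mul, eq_comm] at this

/-- The source of the multiplicative law for the avoidance probabilities of a multiplicative family.
-/
theorem norm_avoid_mul (hrs : r ≤ s) (hst : s ≤ t)
    {x : L2 𝕜 (M.cutClass r s)} {y : L2 𝕜 (M.cutClass s t)} {z : L2 𝕜 (M.cutClass r t)} {c : 𝕜}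
    (hc : ‖c‖ = 1) (h : (hM.isProduct hrs hst).mul 𝕜 x y = c • z) :
    ‖avoid r t z‖ = ‖avoid r s x‖ * ‖avoid s t y‖ := by
  have := congrArg norm (congrArg (avoid r t) h)
  rwa [hM.avoid_mul hrs hst, map_smul, norm_smul, hc, one_mul, IsProduct.norm_mul,
    eq_comm] at this

include hM in
/-- Almost every perfect random set is empty within `[0, 1]` or infinite there. -/
theorem ae_disjoint_or_liminf_eq_top (hperf : M.AlmostAll fun C => Perfect (C : Set ℝ)) :
    (M.cutClass (0 : I) (1 : I)).AlmostAll fun C => C ∈ missIn (0 : I) (1 : I) (0 : I) (1 : I) ∨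
      liminf (fun n => Effros.hitCount n C.1) atTop = ⊤ := by
  rintro _ ⟨μ, hμ, rfl⟩
  refine (ae_map_iff (measurable_cut _ _).aemeasurable ?_).2 ?_
  · exact (measurableSet_missIn _ _ _ _).union (measurableSet_eq_fun
      ((Measurable.liminf Effros.measurable_hitCount).comp measurable_subtype_coe)
      measurable_const)
  · have hmem : ∀ x : ℝ, ∀ᵐ C ∂μ, x ∉ C := fun x =>
      measure_eq_zero_iff_ae_notMem.1 (hM.negligible x μ hμ)
    -- Cutting at `0` and `1` could create isolated endpoints. Almost surely neither endpoint is
    -- hit, so a hit occurs in the open interval, where perfectness yields infinitely many points.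
    filter_upwards [hperf μ hμ, hmem 0, hmem 1] with C hC h0 h1
    rw [or_iff_not_imp_left]
    intro hhit
    obtain ⟨x, ⟨hxC, -⟩, hx0, hx1⟩ := Set.not_disjoint_iff.1 hhit
    have hx : x ∈ Set.Ioo (0 : ℝ) 1 :=
      ⟨lt_of_le_of_ne hx0 fun h => h0 (h ▸ hxC), lt_of_le_of_ne hx1 fun h => h1 (h ▸ hxC)⟩
    refine Effros.liminf_hitCount_eq_top
      ((Effros.infinite_inter_of_perfect hC isOpen_Ioo ⟨x, hxC, hx⟩).mono ?_)
    exact fun y hy => ⟨⟨hy.1, hy.2.1.le, hy.2.2.le⟩, hy.2.1.le, hy.2.2⟩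

/-- For a perfect random set, every multiplicative family of unit vectors is supported by the
empty set. -/
theorem avoid_eq_self_of_multiplicative
    (hperf : M.AlmostAll fun C => Perfect (C : Set ℝ))
    (φ : ∀ {s t : I}, s < t → L2 𝕜 (M.cutClass s t)) (hφ : ∀ {s t : I} (h : s < t), ‖φ h‖ = 1)
    (hmul : ∀ {r s t : I} (hrs : r < s) (hst : s < t), ∃ c : 𝕜, ‖c‖ = 1 ∧
      (hM.isProduct hrs.le hst.le).mul 𝕜 (φ hrs) (φ hst) = c • φ (hrs.trans hst))
    {s t : I} (h : s < t) : avoid s t (φ h) = φ h := by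
  have h01 : (0 : I) < 1 := zero_lt_one
  -- Consistency: `φ_{0,1}` and `φ_{s,t}` give the same probability of missing `[s, t]`. The factors
  -- over `[0, s]` and `[t, 1]` are split off in turn; the cases `s = 0` and `t = 1` are separate
  -- because a degenerate interval carries no Hilbert space.
  have hnorm : ∀ {s t : I} (h : s < t), ‖avoid s t (φ h01)‖ = ‖avoid s t (φ h)‖ := by
    have hright : ∀ {s t : I} (h : s < t) (h' : s < 1),
        ‖avoid s t (φ h')‖ = ‖avoid s t (φ h)‖ := by
      intro s t h h'
      obtain rfl | ht := eq_or_lt_of_le (show t ≤ 1 from unitInterval.le_one')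
      · rfl
      · obtain ⟨c, hc, hc'⟩ := hmul h ht
        exact hM.norm_avoid_left h.le ht.le le_rfl le_rfl (hφ ht) hc hc'
    intro s t h
    obtain rfl | hs := eq_or_lt_of_le (show 0 ≤ s from unitInterval.nonneg')
    · exact hright h h01
    · have hs1 : s < 1 := h.trans_le unitInterval.le_one'
      obtain ⟨c, hc, hc'⟩ := hmul hs hs1
      exact (hM.norm_avoid_right hs.le hs1.le le_rfl unitInterval.le_one' (hφ hs) hc hc').trans
        (hright h hs1)
  have hdprob : ∀ {s t : I} (h : s < t), IsProbabilityMeasure (density (φ h)) := fun h =>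
    ⟨by rw [density_univ, ← ofReal_norm, hφ h]; simp⟩
  have := hdprob h01
  have hνm : ∀ {A : Set (Closeds ℝ)}, MeasurableSet A →
      ((density (φ h01)).map Subtype.val) A = density (φ h01) (Subtype.val ⁻¹' A) :=
    fun hA => Measure.map_apply measurable_subtype_coe hA
  have hνprob : IsProbabilityMeasure ((density (φ h01)).map Subtype.val) :=
    Measure.isProbabilityMeasure_map measurable_subtype_coe.aemeasurable
  have hq : ∀ s t : ℝ, ((density (φ h01)).map Subtype.val).real (Effros.missSet s t) =
      ‖avoid s t (φ h01)‖ ^ 2 := fun s t => by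
    rw [measureReal_def, hνm (Effros.measurableSet_missSet s t), ← measureReal_def]
    exact density_real_apply (measurableSet_missIn _ _ s t) _
  have h0 : ∀ x : ℝ, ((density (φ h01)).map Subtype.val) {C | x ∈ C} = 0 := fun x => by
    rw [hνm (Effros.measurableSet_mem x)]
    refine density_ac _ (ref _) ?_
    exact measure_eq_zero_iff_ae_notMem.2 (hM.ae_notMem _ _ x _ (ref _).2)
  -- The multiplicative law is also needed for degenerate intervals, where it follows from the
  -- absence of fixed points.
  have hq1 : ∀ x : ℝ, ((density (φ h01)).map Subtype.val).real (Effros.missSet x x) = 1 := by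
    intro x
    rw [Effros.missSet_self, probReal_compl_eq_one_sub (Effros.measurableSet_mem x),
      measureReal_def, h0]
    simp
  have hfin := Effros.ae_liminf_hitCount_lt_top h0 fun r s t hr hrs hst ht => by
    obtain rfl | hrs' := eq_or_lt_of_le hrs
    · rw [hq1, one_mul]
    obtain rfl | hst' := eq_or_lt_of_le hst
    · rw [hq1, mul_one]
    rw [hq, hq, hq]
    have h1 : (⟨r, hr, hrs.trans (hst.trans ht)⟩ : I) < ⟨s, hr.trans hrs, hst.trans ht⟩ := hrs'
    have h2 : (⟨s, hr.trans hrs, hst.trans ht⟩ : I) < ⟨t, hr.trans (hrs.trans hst), ht⟩ := hst'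
    obtain ⟨c, hc, hc'⟩ := hmul h1 h2
    have e1 := hnorm (h1.trans h2)
    have e2 := hnorm h1
    have e3 := hnorm h2
    have e4 := hM.norm_avoid_mul h1.le h2.le hc hc'
    rw [← e1, ← e2, ← e3] at e4
    rw [← mul_pow]
    exact congrArg (· ^ 2) e4
  -- Under `|φ_{0,1}|²` the lower limit of the hit counts is finite a.s., whereas for a nonempty cut
  -- of a perfect set it is a.s. infinite; only `∅` remains.
  have hone : density (φ h01) (missIn (0 : I) (1 : I) (0 : I) (1 : I))ᶜ = 0 := by
    refine measure_eq_zero_iff_ae_notMem.2 ?_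
    filter_upwards [ae_of_ae_map measurable_subtype_coe.aemeasurable hfin,
      (density_ac (φ h01) (ref _)).ae_le
        (hM.ae_disjoint_or_liminf_eq_top hperf _ (ref _).2)] with C h1 h2 h3
    exact h2.elim h3 fun h => h1.ne h
  have := hdprob h
  refine restrict_eq_self_of_density _ ?_
  -- By `hnorm` the claim on `[s, t]` becomes one about `|φ_{0,1}|²`, and missing `[0, 1]` implies
  -- missing `[s, t]`.
  rw [prob_compl_eq_zero_iff (measurableSet_missIn _ _ _ _),
    density_apply (measurableSet_missIn _ _ _ _), ← ofReal_norm, ← hnorm h, ofReal_norm,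
    ← density_apply (measurableSet_missIn _ _ _ _)]
  rw [prob_compl_eq_zero_iff (measurableSet_missIn _ _ _ _)] at hone
  exact le_antisymm prob_le_one (hone.symm.le.trans (measure_mono
    (Set.preimage_mono (Effros.missSet_anti s.2.1 t.2.2))))

/-! ### Isomorphisms preserve avoidance operators, hence measures -/

variable {M' : MeasureClass (Closeds ℝ)}

/-- Products of vacuum vectors are vacuum vectors, up to a phase. -/
theorem mul_vacuum (hrs : r ≤ s) (hst : s ≤ t) {x : L2 𝕜 (M.cutClass r s)}
    {y : L2 𝕜 (M.cutClass s t)} {z : L2 𝕜 (M.cutClass r t)}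
    (hx : avoid r s x = x) (hx1 : ‖x‖ = 1) (hy : avoid s t y = y) (hy1 : ‖y‖ = 1)
    (hz : avoid r t z = z) (hz1 : ‖z‖ = 1) :
    ∃ c : 𝕜, ‖c‖ = 1 ∧ (hM.isProduct hrs hst).mul 𝕜 x y = c • z := by
  have h1 := hM.avoid_mul hrs hst x y
  -- The product is fixed by the projection to the line of `z`, so it equals `⟨z, xy⟩ z`; comparing
  -- norms gives the modulus of the coefficient.
  rw [hx, hy, avoid, restrict_eq_inner_smul _ (missIn_subsingleton r t) hz hz1] at h1
  refine ⟨_, ?_, h1.symm⟩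
  have h2 := congrArg norm h1
  rwa [norm_smul, hz1, mul_one, IsProduct.norm_mul, hx1, hy1, mul_one] at h2

/-- Multiplicative unitary operators intertwine the operators of avoiding subintervals, for
perfect random sets. -/
theorem map_avoid (hM' : M'.IsDecomposable)
    (hperf' : M'.AlmostAll fun C => Perfect (C : Set ℝ))
    (U : ∀ {s t : I}, s < t → L2 𝕜 (M.cutClass s t) ≃ₗᵢ[𝕜] L2 𝕜 (M'.cutClass s t))
    (hU : ∀ {r s t : I} (hrs : r < s) (hst : s < t) (x : L2 𝕜 (M.cutClass r s))
      (y : L2 𝕜 (M.cutClass s t)), U (hrs.trans hst) ((hM.isProduct hrs.le hst.le).mul 𝕜 x y) =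
        (hM'.isProduct hrs.le hst.le).mul 𝕜 (U hrs x) (U hst y))
    {s t : I} (h : s < t) (x : L2 𝕜 (M.cutClass (0 : I) (1 : I))) :
    U zero_lt_one (avoid s t x) = avoid s t (U zero_lt_one x) := by
  choose w hw hw1 using fun s t : I =>
    hM.exists_vacuum 𝕜 (s := s) (t := t) unitInterval.nonneg' unitInterval.le_one'
  -- The images of vacuum vectors form a multiplicative family for the perfect class `M'`, hence are
  -- vacuum vectors themselves.
  have hφ : ∀ {s t : I} (h : s < t), avoid s t (U h (w s t)) = U h (w s t) := by
    refine fun h => hM'.avoid_eq_self_of_multiplicative hperf' (fun {s t} h => U h (w s t))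
      (fun h => by rw [LinearIsometryEquiv.norm_map, hw1]) (fun {r s t} hrs hst => ?_) h
    obtain ⟨c, hc, hc'⟩ := hM.mul_vacuum hrs.le hst.le (hw r s) (hw1 r s) (hw s t) (hw1 s t)
      (hw r t) (hw1 r t)
    exact ⟨c, hc, by rw [← hU, hc', map_smul]⟩
  -- On `H_{s,t}` both operators are rank-one projections, to the lines of `w s t` and of its image
  -- under `U`.
  have hbase : ∀ {s t : I} (h : s < t) (x : L2 𝕜 (M.cutClass s t)),
      U h (avoid s t x) = avoid s t (U h x) := by
    intro s t h x
    rw [avoid, avoid, restrict_eq_inner_smul _ (missIn_subsingleton _ _) (hw s t) (hw1 s t),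
      restrict_eq_inner_smul _ (missIn_subsingleton _ _) (hφ h)
        (by rw [LinearIsometryEquiv.norm_map, hw1]), LinearIsometryEquiv.inner_map_map, map_smul]
  have hcont : ∀ {s t u v : I} (h : s < t),
      Continuous ((U h).toLinearEquiv.toLinearMap ∘ₗ avoid u v) ∧
      Continuous (avoid u v ∘ₗ (U h).toLinearEquiv.toLinearMap) := fun h =>
    ⟨(U h).continuous.comp (continuous_restrict (measurableSet_missIn _ _ _ _)),
      (continuous_restrict (measurableSet_missIn _ _ _ _)).comp (U h).continuous⟩
  -- The identity passes from `[s, t]` to `[s, 1]`, and afterwards to `[0, 1]`, by checking it on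
  -- products, where the avoidance operator affects a single factor.
  have hright : ∀ {s t : I} (h : s < t) (h' : s < 1) (x : L2 𝕜 (M.cutClass s (1 : I))),
      U h' (avoid s t x) = avoid s t (U h' x) := by
    intro s t h h'
    obtain rfl | ht := eq_or_lt_of_le (show t ≤ 1 from unitInterval.le_one')
    · exact hbase h
    · refine (hM.isProduct h.le ht.le).ext_mul (hcont h').1 (hcont h').2 fun x y => ?_
      change U h' (avoid s t _) = avoid s t (U h' _)
      rw [hM.avoid_mul_left h.le ht.le le_rfl le_rfl, hU h ht, hU h ht,
        hM'.avoid_mul_left h.le ht.le le_rfl le_rfl, hbase]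
  revert x
  obtain rfl | hs := eq_or_lt_of_le (show 0 ≤ s from unitInterval.nonneg')
  · exact hright h zero_lt_one
  · have hs1 : s < 1 := h.trans_le unitInterval.le_one'
    refine (hM.isProduct hs.le hs1.le).ext_mul (hcont _).1 (hcont _).2 fun x y => ?_
    change U _ (avoid s t _) = avoid s t (U _ _)
    rw [hM.avoid_mul_right hs.le hs1.le le_rfl unitInterval.le_one', hU hs hs1, hU hs hs1,
      hM'.avoid_mul_right hs.le hs1.le le_rfl unitInterval.le_one', hright h hs1]

end IsDecomposable

/-- A unitary operator that intertwines the operators of avoiding subintervals preserves the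
measures `|x|²`. -/
theorem density_map_eq {𝕜 : Type*} [RCLike 𝕜]
    {N N' : MeasureClass (ClosedIn (0 : I) (1 : I))} (U : L2 𝕜 N ≃ₗᵢ[𝕜] L2 𝕜 N')
    (hU : ∀ {s t : I}, s < t → ∀ x, U (avoid s t x) = avoid s t (U x)) (x : L2 𝕜 N) :
    density (U x) = density x := by
  -- Intertwined indicators are closed under products, so `P` is a π-system containing the
  -- generating avoidance events. As `U` is isometric, the two finite measures agree on `P` and have
  -- equal total mass.
  set P : Set (Set (ClosedIn (0 : I) (1 : I))) :=
    {A | ∃ hA : MeasurableSet A, ∀ x, U (restrict hA x) = restrict hA (U x)} with hP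
  have hPi : IsPiSystem P := by
    rintro A ⟨hA, hA'⟩ B ⟨hB, hB'⟩ -
    refine ⟨hA.inter hB, fun x => ?_⟩
    rw [← restrict_restrict hA hB, hA', hB', restrict_restrict hA hB]
  have hgen : Subtype.instMeasurableSpace = MeasurableSpace.generateFrom P := by
    refine le_antisymm (measurableSpace_closedIn_le _ fun s t h => ?_)
      (MeasurableSpace.generateFrom_le fun A hA => hA.1)
    exact MeasurableSpace.measurableSet_generateFrom ⟨measurableSet_missIn _ _ _ _, hU h⟩
  refine ext_of_generate_finite P hgen hPi ?_ ?_
  · rintro A ⟨hA, hA'⟩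
    rw [density_apply hA, density_apply hA, ← hA', ← ofReal_norm, LinearIsometryEquiv.norm_map,
      ofReal_norm]
  · rw [density_univ, density_univ, ← ofReal_norm, LinearIsometryEquiv.norm_map, ofReal_norm]

/-- Each measure of `N` is some `|x|² = |U x|²`, hence dominated by `N'`; the converse uses the
inverse of `U`. -/
theorem eq_of_density_map_eq {𝕜 X : Type*} [RCLike 𝕜] [MeasurableSpace X]
    {N N' : MeasureClass X} (U : L2 𝕜 N ≃ₗᵢ[𝕜] L2 𝕜 N')
    (hU : ∀ x, density (U x) = density x) : N = N' := by
  refine eq_of_forall_ac (fun μ hμ => ⟨(ref N').1, (ref N').2, ?_⟩)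
    fun ν hν => ⟨(ref N).1, (ref N).2, ?_⟩
  · obtain ⟨x, hx⟩ := exists_density_eq (𝕜 := 𝕜) (M := N) ⟨μ, hμ⟩
    change (⟨μ, hμ⟩ : N.carrier).1 ≪ _
    rw [← hx, ← hU]
    exact density_ac _ _
  · obtain ⟨y, hy⟩ := exists_density_eq (𝕜 := 𝕜) (M := N') ⟨ν, hν⟩
    change (⟨ν, hν⟩ : N'.carrier).1 ≪ _
    rw [← hy, ← U.apply_symm_apply y, hU]
    exact density_ac _ _

end MeasureClass

end

theorem corollary5p9 {𝕜 : Type*} [RCLike 𝕜]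
    (M M' : MeasureClass (TopologicalSpace.Closeds ℝ))
    (hM : M.IsDecomposable) (hM' : M'.IsDecomposable)
    (hperfect : M.AlmostAll fun C => Perfect (C : Set ℝ))
    (hperfect' : M'.AlmostAll fun C => Perfect (C : Set ℝ))
    (hne : M.cutClass 0 1 ≠ M'.cutClass 0 1) :
    IsEmpty (CPHS.Iso (hM.cphs 𝕜) (hM'.cphs 𝕜)) := by
  refine ⟨fun F => hne ?_⟩
  let U : ∀ {s t : unitInterval}, s < t →
    MeasureClass.L2 𝕜 (M.cutClass s t) ≃ₗᵢ[𝕜] MeasureClass.L2 𝕜 (M'.cutClass s t) :=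
    fun h => F.U h
  refine MeasureClass.eq_of_density_map_eq (U zero_lt_one) (MeasureClass.density_map_eq _
    fun h x => hM.map_avoid hM' hperfect' U (fun hrs hst x y => ?_) h x)
  -- The compatibility in `F.comm` is stated through the unitaries `W`; on a vector `x ⊗ y` these
  -- are the bilinear products `mul`.
  have h₁ := unitaryOfBilin_htmul ((hM.isProduct hrs.le hst.le).mul 𝕜)
    ((hM.isProduct hrs.le hst.le).inner_mul 𝕜) ((hM.isProduct hrs.le hst.le).span_mul_dense 𝕜) x y
  have h₂ := unitaryOfBilin_htmul ((hM'.isProduct hrs.le hst.le).mul 𝕜)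
    ((hM'.isProduct hrs.le hst.le).inner_mul 𝕜) ((hM'.isProduct hrs.le hst.le).span_mul_dense 𝕜)
    (U hrs x) (U hst y)
  exact (congrArg (U (hrs.trans hst)) h₁).symm.trans ((F.comm hrs hst x y).trans h₂)
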